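/- Let $b\ge 2$ be an integer and $\omega_b=\exp(2\pi\sqrt{-1}/b)$. Write a nonnegative integer $k$ in base $b$ as $k=\kappa_1b^{a_1-1}+\dots+\kappa_vb^{a_v-1}$ with integers $0<\kappa_i\le b-1$ and $a_1>\dots>a_v\ge 1$ (with $v=0$ for $k=0$). Put $v(k):=v$ and, for an integer $\alpha\ge 0$, $\mu_\alpha(k):=a_1+\dots+a_{\min(\alpha,v)}$ (an empty sum is $0$). For $x\in[0,1)$ with $b$-adic expansion $x=\xi_1b^{-1}+\xi_2b^{-2}+\cdots$, in which infinitely many digits differ from $b-1$, let $\mathrm{wal}_k(x):=\omega_b^{\sum_{i=1}^{v}\kappa_i\xi_{a_i}}$. For $\boldsymbol k=(k_1,\dots,k_s)$ with nonnegative integers $k_j$ let $\mathrm{wal}_{\boldsymbol k}(\boldsymbol x):=\prod_{j=1}^s\mathrm{wal}_{k_j}(x_j)$ and $$\widehat f(\boldsymbol k):=\int_{[0,1)^s}f(\boldsymbol x)\,\overline{\mathrm{wal}_{\boldsymbol k}(\boldsymbol x)}\,d\boldsymbol x .$$ Let $m_b:=\min_{1\le c\le b-1}|1-\omega_b^{-c}|=2\sin(\pi/b)$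 and $M_b:=\max_{1\le c\le b-1}|1-\omega_b^{-c}|$. **Theorem.** Let $\alpha_1,\dots,\alpha_s$ be nonnegative integers and let $f\colon[0,1]^s\to\mathbb R$ have continuous mixed partial derivatives up to order $\alpha_j$ in each variable $x_j$; that is, $f^{(i_1,\dots,i_s)}:=(\partial/\partial x_1)^{i_1}\cdots(\partial/\partial x_s)^{i_s}f$ exists and is continuous on $[0,1]^s$ whenever $0\le i_j\le\alpha_j$ for all $j$ (derivatives being one-sided at the boundary). Let $\boldsymbol k=(k_1,\dots,k_s)$ be a vector of nonnegative integers and $n_j:=\min(\alpha_j,v(k_j))$ for $1\le j\le s$. If $b>2$, then $$|\widehat f(\boldsymbol k)|\le\|f^{(n_1,\dots,n_s)}\|_{L^1([0,1]^s)}\prod_{j=1}^s\frac{b^{-\mu_{\alpha_j}(k_j)}}{m_b^{\,n_j}}\left(M_b+\frac{b\,m_b}{b-M_b}\left(1-\Big(\frac{M_b}{b}\Big)^{n_j}\right)\right)^{\min(1,v(k_j))}.$$ If $b=2$, then for every $1\le p\le\infty$ (with $1/\infty=0$) $$|\widehat f(\boldsymbol k)|\le\|f^{(n_1,\dots,n_s)}\|_{L^p([0,1]^s)}\prod_{j=1}^s2^{-\mu_{\alpha_j}(k_j)-n_j+\min(1,v(k_j))/p}.$$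 -/

import Mathlib

open MeasureTheory
open scoped ENNReal ComplexConjugate

noncomputable section

namespace Walsh

/-- The positions `a₁ > a₂ > ⋯ > a_v ≥ 1` of the non-zero digits of `k` in base `b`, in decreasing
order, where `k = κ₁ b ^ (a₁ - 1) + ⋯ + κ_v b ^ (a_v - 1)` with `0 < κᵢ < b`. -/
def positions (b k : ℕ) : List ℕ :=
  (((List.range (Nat.digits b k).length).filter
    (fun i => (Nat.digits b k).getD i 0 ≠ 0)).map (fun i => i + 1)).reverse

/-- The Hamming weight `v(k)`: the number of non-zero digits of `k` in base `b`. -/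
def weight (b k : ℕ) : ℕ := (positions b k).length

/-- `μ_α(k) = a₁ + ⋯ + a_{min(α, v)}`. -/
def mu (b α k : ℕ) : ℕ := ((positions b k).take α).sum

/-- The primitive root of unity `ω_b = exp(2πi / b)`. -/
def omega (b : ℕ) : ℂ := Complex.exp (2 * Real.pi * Complex.I / b)

/-- The `k`-th Walsh function in base `b`. Here `Nat.digits b k` lists the digits of `k` starting
with the lowest one, and `Real.digits x b i` is the digit of `x ∈ [0,1)` at `b ^ (-(i + 1))`, in
the expansion with infinitely many digits different from `b - 1`. -/
def wal (b : ℕ) [NeZero b] (k : ℕ) (x : ℝ) : ℂ :=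
  omega b ^ (∑ i ∈ Finset.range (Nat.digits b k).length,
    (Nat.digits b k).getD i 0 * (Real.digits x b i : ℕ))

/-- The multivariate Walsh function. -/
def walMulti (b : ℕ) [NeZero b] {s : ℕ} (k : Fin s → ℕ) (x : Fin s → ℝ) : ℂ :=
  ∏ j, wal b (k j) (x j)

/-- The Walsh coefficient of `f` at `k`. -/
def walshCoeff (b : ℕ) [NeZero b] {s : ℕ} (f : (Fin s → ℝ) → ℂ) (k : Fin s → ℕ) : ℂ :=
  ∫ x in Set.univ.pi (fun _ : Fin s => Set.Ico (0 : ℝ) 1), f x * conj (walMulti b k x)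

/-- `m_b = min_{1 ≤ c ≤ b - 1} |1 - ω_b^{-c}|`. -/
def mMin (b : ℕ) : ℝ := ⨅ c : Finset.Icc 1 (b - 1), ‖1 - conj (omega b) ^ (c : ℕ)‖

/-- `M_b = max_{1 ≤ c ≤ b - 1} |1 - ω_b^{-c}|`. -/
def mMax (b : ℕ) : ℝ := ⨆ c : Finset.Icc 1 (b - 1), ‖1 - conj (omega b) ^ (c : ℕ)‖

/-- The constant `(b m_b / (b - M_b)) (1 - (M_b / b) ^ n)`. -/
def constC (b n : ℕ) : ℝ :=
  b * mMin b / (b - mMax b) * (1 - (mMax b / b) ^ n)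

/-- The closed unit cube `[0,1]^s`. -/
def cube (s : ℕ) : Set (Fin s → ℝ) := Set.univ.pi (fun _ => Set.Icc (0 : ℝ) 1)

/-- The first partial derivative in `x_j` on the cube (one-sided on the faces). -/
def partialDeriv {s : ℕ} (j : Fin s) (g : (Fin s → ℝ) → ℝ) : (Fin s → ℝ) → ℝ :=
  fun x => derivWithin (fun t => g (Function.update x j t)) (Set.Icc 0 1) (x j)

/-- `f^{(n_1, …, n_s)} = (∂/∂x_1)^{n_1} ⋯ (∂/∂x_s)^{n_s} f`, where `∂/∂x_s` acts first. -/
def mixedPartial {s : ℕ} (n : Fin s → ℕ) (f : (Fin s → ℝ) → ℝ) : (Fin s → ℝ) → ℝ :=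
  (List.finRange s).foldr (fun j g => (partialDeriv j)^[n j] g) f

/-- `f` has continuous mixed partial derivatives up to order `α_j` in each variable `x_j` on the
cube: for every `n ≤ α` the derivative `f^{(n)}` exists and is continuous on the cube. Existence is
expressed step by step: whenever `n_i = 0` for `i < j` and `n_j < α_j`, the next derivative to be
taken, that of `f^{(n)}` with respect to `x_j`, exists at every point of the cube. -/
def HasContMixedPartials {s : ℕ} (α : Fin s → ℕ) (f : (Fin s → ℝ) → ℝ) : Prop :=
  ∀ n : Fin s → ℕ, n ≤ α →
    ContinuousOn (mixedPartial n f) (cube s) ∧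
    ∀ j : Fin s, (∀ i < j, n i = 0) → n j < α j → ∀ x ∈ cube s,
      DifferentiableWithinAt ℝ (fun t => mixedPartial n f (Function.update x j t))
        (Set.Icc 0 1) (x j)

/-- The `L^p` norm on the unit cube. -/
def cubeNorm {s : ℕ} (p : ℝ≥0∞) (g : (Fin s → ℝ) → ℝ) : ℝ :=
  (eLpNorm g p (volume.restrict (cube s))).toReal

end Walsh

end

/-! Integrating by parts moves the derivatives onto `f` and replaces `conj (wal b k)` by an iterated
primitive; the theorem is then Hölder's inequality with bounds on these one-variable kernels.

The conjugate Walsh function is a product of step characters, the one at position `a` being `ζ ^ i`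
on the `i`-th cell of length `b ^ (-a)`. Integration consumes the positions from the finest, `a₁`,
to coarser ones. The primitive of `ζ ^ i` times a `b ^ (-a)`-periodic function has period `b ^ (-(a
- 1))` and vanishes at multiples of it, since the powers of `ζ` over `b` consecutive cells sum to
zero. The coarser characters are constant between these zeros, so they factor out of the integral
(`charKernel_succ`), and the boundary terms at `0` and `1` disappear. After `r` steps the kernel is
a unimodular factor times `iterInt` along the `r` largest positions.

On cell `c` one integration produces `(∑ i < c, ζ ^ i) * I + ζ ^ c * P y`, with `I` the integral of
the previous kernel over a cell and `P` its primitive. Averaging over `c` leaves `I / (1 - ζ)`, so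
each step multiplies the mean by `b ^ (-a) / (1 - ζ)`. For general `b` the primitive of `iterInt` is
split into a drift governed by the mean and an oscillation; this gives the recursion `C (n + 1) = m
+ (M / b) * C n` behind the constant in the theorem (`norm_integral_iterInt_le`,
`norm_iterInt_cons_le`).

For `b = 2` the only root is `-1`, and the formula alternates between `P y` and `I - P y`. Hence
`iterInt` is nonnegative, its `L¹` norm is its mean and its supremum is at most twice the mean
(`iterInt_two`). Interpolating between the two norms (`enorm_integral_mul_le`) yields the `L^p`
bounds. -/

namespace Walsh

/-! ### Integrals of functions given cell by cell -/

/-- A function on `[0, ∞)` given on each cell `[i L, (i + 1) L)` is integrated cell by cell. -/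
theorem integral_eq_sum_cells {L : ℝ} {h : ℝ → ℂ}
    (hh : ∀ u v, IntervalIntegrable h volume u v) (c : ℕ) (y : ℝ) :
    ∫ t in (0 : ℝ)..(c * L + y), h t =
      (∑ i ∈ Finset.range c, ∫ z in (0 : ℝ)..L, h (i * L + z)) +
        ∫ z in (0 : ℝ)..y, h (c * L + z) := by
  have h1 : ∀ (i : ℕ) (w : ℝ), ∫ z in (0 : ℝ)..w, h (i * L + z) =
      ∫ t in (i * L : ℝ)..(i * L + w), h t := by
    intro i w
    rw [intervalIntegral.integral_comp_add_left (fun t => h t)]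
    simp
  rw [h1]
  have h2 : ∑ i ∈ Finset.range c, ∫ z in (0 : ℝ)..L, h (i * L + z) =
      ∫ t in (0 : ℝ)..(c * L), h t := by
    have := intervalIntegral.sum_integral_adjacent_intervals (μ := volume) (f := h)
      (a := fun i : ℕ => (i * L : ℝ)) (n := c) (fun k _ => hh _ _)
    simp only [Nat.cast_zero, zero_mul] at this
    rw [← this]
    refine Finset.sum_congr rfl fun i _ => ?_
    rw [h1]
    push_cast
    ring_nf
  rw [h2, intervalIntegral.integral_add_adjacent_intervals (hh _ _) (hh _ _)]

/-- Every nonnegative real lies in a cell. -/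
theorem exists_cell {L : ℝ} (hL : 0 < L) {x : ℝ} (hx : 0 ≤ x) :
    ∃ (c : ℕ) (y : ℝ), 0 ≤ y ∧ y < L ∧ x = c * L + y := by
  refine ⟨⌊x / L⌋₊, x - ⌊x / L⌋₊ * L, ?_, ?_, by ring⟩
  · have := (le_div_iff₀ hL).1 (Nat.floor_le (div_nonneg hx hL.le))
    linarith
  · have := (div_lt_iff₀ hL).1 (Nat.lt_floor_add_one (x / L))
    linarith

/-- The function with value `ζ ^ i` on the cell `[i L, (i + 1) L)`. -/
noncomputable def stepChar (L : ℝ) (ζ : ℂ) (t : ℝ) : ℂ := ζ ^ ⌊t / L⌋₊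

theorem stepChar_cell {L : ℝ} (hL : 0 < L) (ζ : ℂ) (i : ℕ) {z : ℝ} (h0 : 0 ≤ z) (h1 : z < L) :
    stepChar L ζ (i * L + z) = ζ ^ i := by
  have : ⌊(i * L + z) / L⌋₊ = i := by
    rw [Nat.floor_eq_iff (by positivity), le_div_iff₀ hL, div_lt_iff₀ hL]
    constructor <;> nlinarith
  rw [stepChar, this]

theorem measurable_stepChar (L : ℝ) (ζ : ℂ) : Measurable (stepChar L ζ) := by
  have h : Measurable fun n : ℕ => ζ ^ n := measurable_from_nat
  exact h.comp (Nat.measurable_floor.comp (measurable_id.div_const L))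

theorem norm_stepChar (L : ℝ) {ζ : ℂ} (hζ : ‖ζ‖ = 1) (t : ℝ) : ‖stepChar L ζ t‖ = 1 := by
  rw [stepChar, norm_pow, hζ, one_pow]

/-- `stepChar` is right-continuous on `[0, ∞)`. -/
theorem stepChar_continuousWithinAt {L : ℝ} (hL : 0 < L) (ζ : ℂ) {x : ℝ} (hx : 0 ≤ x) :
    ContinuousWithinAt (stepChar L ζ) (Set.Ioi x) x := by
  obtain ⟨c, y, hy0, hy1, rfl⟩ := exists_cell hL hx
  have hev : stepChar L ζ =ᶠ[nhdsWithin (c * L + y) (Set.Ioi (c * L + y))] fun _ => ζ ^ c := by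
    have : Set.Ioo (c * L + y) (c * L + L) ∈
        nhdsWithin (c * L + y) (Set.Ioi (c * L + y)) := Ioo_mem_nhdsGT (by linarith)
    filter_upwards [this] with t ht
    have := stepChar_cell hL ζ c (z := t - c * L) (by linarith [ht.1]) (by linarith [ht.2])
    rwa [add_sub_cancel] at this
  exact continuousWithinAt_const.congr_of_eventuallyEq hev (stepChar_cell hL ζ c hy0 hy1)

theorem intervalIntegrable_stepChar_mul {L : ℝ} {ζ : ℂ} (hζ : ‖ζ‖ = 1) {U : ℝ → ℂ}
    (hU : ∀ u v, IntervalIntegrable U volume u v) (u v : ℝ) :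
    IntervalIntegrable (fun t => stepChar L ζ t * U t) volume u v := by
  refine (hU u v).mono_fun ?_ ?_
  · exact (measurable_stepChar L ζ).aestronglyMeasurable.mul
      (hU u v).aestronglyMeasurable_restrict_uIoc
  · refine Filter.Eventually.of_forall fun t => ?_
    simp only [norm_mul, norm_stepChar L hζ, one_mul, le_refl]

/-! ### One step of the iterated integration -/

/-- The primitive of a step character times an `L`-periodic function, cell by cell. -/
theorem integral_stepChar_mul_cell {L : ℝ} (hL : 0 < L) {ζ : ℂ} (hζ : ‖ζ‖ = 1) {U : ℝ → ℂ}
    (hU : Continuous U) (hper : ∀ (i : ℕ) (z : ℝ), 0 ≤ z → U (i * L + z) = U z)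
    (c : ℕ) {y : ℝ} (hy0 : 0 ≤ y) (hy1 : y ≤ L) :
    ∫ t in (0 : ℝ)..(c * L + y), stepChar L ζ t * U t =
      (∑ i ∈ Finset.range c, ζ ^ i) * (∫ z in (0 : ℝ)..L, U z) +
        ζ ^ c * ∫ z in (0 : ℝ)..y, U z := by
  rw [integral_eq_sum_cells (intervalIntegrable_stepChar_mul hζ
    fun u v => hU.intervalIntegrable u v)]
  have key : ∀ (i : ℕ) (w : ℝ), 0 ≤ w → w ≤ L →
      ∫ z in (0 : ℝ)..w, stepChar L ζ (i * L + z) * U (i * L + z) =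
        ζ ^ i * ∫ z in (0 : ℝ)..w, U z := by
    intro i w hw0 hw1
    rw [← intervalIntegral.integral_const_mul]
    refine intervalIntegral.integral_congr_Ioo_of_le hw0 fun z hz => ?_
    rw [stepChar_cell hL ζ i hz.1.le (hz.2.trans_le hw1), hper i z hz.1.le]
  rw [key c y hy0 hy1, Finset.sum_mul]
  congr 1
  exact Finset.sum_congr rfl fun i _ => key i L hL.le le_rfl

theorem sum_range_pow_mul_period {b : ℕ} {ζ : ℂ} (hb : ζ ^ b = 1) (h1 : ζ ≠ 1) (N : ℕ) :
    ∑ i ∈ Finset.range (N * b), ζ ^ i = 0 := by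
  rw [geom_sum_eq h1, mul_comm N b, pow_mul, hb, one_pow, sub_self, zero_div]

/-- The primitive has period `b L`, where `b` is an exponent of `ζ`. -/
theorem integral_stepChar_mul_periodic {L : ℝ} (hL : 0 < L) {ζ : ℂ} (hζ : ‖ζ‖ = 1) {b : ℕ}
    (hb : ζ ^ b = 1) (h1 : ζ ≠ 1) {U : ℝ → ℂ}
    (hU : Continuous U) (hper : ∀ (i : ℕ) (z : ℝ), 0 ≤ z → U (i * L + z) = U z)
    (N : ℕ) {x : ℝ} (hx : 0 ≤ x) :
    ∫ t in (0 : ℝ)..((N * b : ℕ) * L + x), stepChar L ζ t * U t =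
      ∫ t in (0 : ℝ)..x, stepChar L ζ t * U t := by
  obtain ⟨c, y, hy0, hy1, rfl⟩ := exists_cell hL hx
  have : ((N * b : ℕ) : ℝ) * L + (c * L + y) = ((N * b + c : ℕ) : ℝ) * L + y := by
    push_cast; ring
  rw [this, integral_stepChar_mul_cell hL hζ hU hper _ hy0 hy1.le,
    integral_stepChar_mul_cell hL hζ hU hper _ hy0 hy1.le, Finset.sum_range_add,
    sum_range_pow_mul_period hb h1, zero_add]
  have h2 : ζ ^ (N * b) = 1 := by rw [mul_comm, pow_mul, hb, one_pow]
  simp only [pow_add, h2, one_mul]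

/-- The integral of the primitive over an initial segment, cell by cell. -/
theorem integral_integral_stepChar_mul_cell {L : ℝ} (hL : 0 < L) {ζ : ℂ} (hζ : ‖ζ‖ = 1)
    {U : ℝ → ℂ} (hU : Continuous U)
    (hper : ∀ (i : ℕ) (z : ℝ), 0 ≤ z → U (i * L + z) = U z)
    (c : ℕ) {y : ℝ} (hy0 : 0 ≤ y) (hy1 : y ≤ L) :
    ∫ x in (0 : ℝ)..(c * L + y), ∫ t in (0 : ℝ)..x, stepChar L ζ t * U t =
      (∑ i ∈ Finset.range c, ((L : ℂ) * ((∑ e ∈ Finset.range i, ζ ^ e) *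
          ∫ z in (0 : ℝ)..L, U z) + ζ ^ i * ∫ w in (0 : ℝ)..L, ∫ z in (0 : ℝ)..w, U z)) +
        ((y : ℂ) * ((∑ e ∈ Finset.range c, ζ ^ e) *
          ∫ z in (0 : ℝ)..L, U z) + ζ ^ c * ∫ w in (0 : ℝ)..y, ∫ z in (0 : ℝ)..w, U z) := by
  have hint : ∀ u v, IntervalIntegrable (fun t => stepChar L ζ t * U t) volume u v :=
    intervalIntegrable_stepChar_mul hζ fun u v => hU.intervalIntegrable u v
  have hcont := intervalIntegral.continuous_primitive hint 0
  have hcontU := intervalIntegral.continuous_primitive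
    (fun u v => hU.intervalIntegrable (μ := volume) u v) 0
  rw [integral_eq_sum_cells fun u v => hcont.intervalIntegrable u v]
  have key : ∀ (i : ℕ) (w : ℝ), 0 ≤ w → w ≤ L →
      ∫ x in (0 : ℝ)..w, ∫ t in (0 : ℝ)..(i * L + x), stepChar L ζ t * U t =
        (w : ℂ) * ((∑ e ∈ Finset.range i, ζ ^ e) *
          ∫ z in (0 : ℝ)..L, U z) + ζ ^ i * ∫ x in (0 : ℝ)..w, ∫ z in (0 : ℝ)..x, U z := by
    intro i w hw0 hw1
    have : ∫ x in (0 : ℝ)..w, ∫ t in (0 : ℝ)..(i * L + x), stepChar L ζ t * U t =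
        ∫ x in (0 : ℝ)..w, ((∑ e ∈ Finset.range i, ζ ^ e) * (∫ z in (0 : ℝ)..L, U z) +
          ζ ^ i * ∫ z in (0 : ℝ)..x, U z) := by
      refine intervalIntegral.integral_congr_Ioo_of_le hw0 fun z hz => ?_
      exact integral_stepChar_mul_cell hL hζ hU hper i hz.1.le (hz.2.le.trans hw1)
    rw [this, intervalIntegral.integral_add (by simp)
      ((hcontU.intervalIntegrable _ _).const_mul _), intervalIntegral.integral_const_mul,
      intervalIntegral.integral_const]
    simp [mul_left_comm]
  rw [key c y hy0 hy1]
  congr 1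
  exact Finset.sum_congr rfl fun i _ => key i L hL.le le_rfl

theorem geom_sum_eq_div {ζ : ℂ} (h1 : ζ ≠ 1) (c : ℕ) :
    ∑ i ∈ Finset.range c, ζ ^ i = (1 - ζ ^ c) / (1 - ζ) := by
  rw [geom_sum_eq h1, ← neg_sub, ← neg_sub (1 : ℂ) ζ, neg_div_neg_eq]

/-- The mean of the primitive over multiples of its period. -/
theorem integral_integral_stepChar_mul {L : ℝ} (hL : 0 < L) {ζ : ℂ} (hζ : ‖ζ‖ = 1) {b : ℕ}
    (hb : ζ ^ b = 1) (h1 : ζ ≠ 1) {U : ℝ → ℂ} (hU : Continuous U)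
    (hper : ∀ (i : ℕ) (z : ℝ), 0 ≤ z → U (i * L + z) = U z) (N : ℕ) :
    ∫ x in (0 : ℝ)..((N * b : ℕ) * L), ∫ t in (0 : ℝ)..x, stepChar L ζ t * U t =
      ((N * b : ℕ) * L : ℝ) * ((∫ z in (0 : ℝ)..L, U z) / (1 - ζ)) := by
  have h := integral_integral_stepChar_mul_cell hL hζ hU hper (N * b) le_rfl hL.le
  have h2 : (1 - ζ) ≠ 0 := sub_ne_zero.2 h1.symm
  rw [add_zero, intervalIntegral.integral_same] at h
  rw [h]
  -- Over whole periods the powers of `ζ` cancel; only the constant part `1 / (1 - ζ)` of each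
  -- partial geometric sum survives.
  simp only [Finset.sum_add_distrib, ← Finset.sum_mul, ← Finset.mul_sum,
    sum_range_pow_mul_period hb h1, geom_sum_eq_div h1, ← Finset.sum_div,
    Finset.sum_sub_distrib]
  simp only [Finset.sum_const, Finset.card_range]
  push_cast
  simp
  field_simp

/-- Partial sums of `1 - ζ ^ i` increase in modulus. -/
theorem norm_sum_one_sub_pow_mono {ζ : ℂ} (hζ : ‖ζ‖ = 1) (h1 : ζ ≠ 1) :
    Monotone fun c : ℕ => ‖∑ i ∈ Finset.range c, (1 - ζ ^ i)‖ := by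
  refine monotone_nat_of_le_succ fun c => ?_
  refine le_of_sq_le_sq ?_ (norm_nonneg _)
  have h2 : (1 - ζ) ≠ 0 := sub_ne_zero.2 h1.symm
  set S := (1 - ζ ^ c) / (1 - ζ) with hS
  have hF : ∑ i ∈ Finset.range c, (1 - ζ ^ i) = c - S := by
    rw [Finset.sum_sub_distrib, geom_sum_eq_div h1]; simp [hS]
  have hw : 1 - ζ ^ c = S * (1 - ζ) := by rw [hS, div_mul_cancel₀ _ h2]
  have hre : 0 ≤ (1 - ζ ^ c).re := by
    have := (Complex.re_le_norm (ζ ^ c)).trans_eq (by rw [norm_pow, hζ, one_pow])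
    simpa using this
  have hpq : ζ.re * ζ.re + ζ.im * ζ.im = 1 := by
    rw [← Complex.normSq_apply, ← Complex.sq_norm, hζ, one_pow]
  rw [Finset.sum_range_succ, hF, Complex.sq_norm, Complex.sq_norm, Complex.normSq_add]
  -- With `w = 1 - ζ ^ c = S * (1 - ζ)` and `|1 - ζ|² = 2 Re (1 - ζ)`, one has `Re (S * conj w) =
  -- |w|² / 2`. The increment of the squared modulus is therefore exactly `2 c Re w ≥ 0`.
  have h3 : ((c - S) * conj (1 - ζ ^ c)).re =
      c * (1 - ζ ^ c).re - Complex.normSq (1 - ζ ^ c) / 2 := by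
    rw [hw]
    simp only [Complex.normSq_apply, Complex.mul_re, Complex.mul_im, Complex.sub_re,
      Complex.sub_im, Complex.conj_re, Complex.conj_im, Complex.one_re, Complex.one_im,
      Complex.natCast_re, Complex.natCast_im]
    linear_combination (S.re ^ 2 + S.im ^ 2) / 2 * hpq
  rw [h3]
  have := mul_nonneg (Nat.cast_nonneg (α := ℝ) c) hre
  linarith

theorem norm_sum_one_sub_pow_le {b : ℕ} {ζ : ℂ} (hζ : ‖ζ‖ = 1) (h1 : ζ ≠ 1) (hb : ζ ^ b = 1)
    (N : ℕ) {c : ℕ} (hc : c ≤ N * b) :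
    ‖∑ i ∈ Finset.range c, (1 - ζ ^ i)‖ ≤ (N * b : ℕ) := by
  refine (norm_sum_one_sub_pow_mono hζ h1 hc).trans ?_
  simp only [Finset.sum_sub_distrib, sum_range_pow_mul_period hb h1]
  simp

/-! ### Iterated integrals along a list of digit positions -/

/-- The iterated integral along the digit positions in `l` (increasing), where the digit at
position `a` contributes the step character with root of unity `z a`. -/
noncomputable def iterInt (b : ℕ) (z : ℕ → ℂ) : List ℕ → ℝ → ℂ
  | [] => fun _ => 1
  | a :: l => fun x => ∫ t in (0 : ℝ)..x, stepChar ((b : ℝ) ^ a)⁻¹ (z a) t * iterInt b z l t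

/-- The mean of `iterInt b z l`. -/
noncomputable def iterMean (b : ℕ) (z : ℕ → ℂ) : List ℕ → ℂ
  | [] => 1
  | a :: l => (((b : ℝ) ^ a)⁻¹ : ℝ) * iterMean b z l / (1 - z a)

/-- `z a` is a `b`-th root of unity different from `1`, for every `a ∈ l`. -/
def RootsOn (b : ℕ) (z : ℕ → ℂ) (l : List ℕ) : Prop := ∀ a ∈ l, z a ≠ 1 ∧ z a ^ b = 1

theorem RootsOn.tail {b : ℕ} {z : ℕ → ℂ} {a : ℕ} {l : List ℕ} (h : RootsOn b z (a :: l)) :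
    RootsOn b z l := fun c hc => h c (List.mem_cons_of_mem _ hc)

theorem RootsOn.norm_eq {b : ℕ} (hb : b ≠ 0) {z : ℕ → ℂ} {l : List ℕ} (h : RootsOn b z l)
    {a : ℕ} (ha : a ∈ l) : ‖z a‖ = 1 :=
  Complex.norm_eq_one_of_pow_eq_one (h a ha).2 hb

/-- A coarse cell consists of a whole number of blocks of `b` fine cells, that is, of periods of the
primitive at position `a`. -/
theorem inv_pow_eq_mul {b : ℕ} (hb : b ≠ 0) {a' a : ℕ} (h : a' < a) :
    ((b : ℝ) ^ a')⁻¹ = ((b ^ (a - 1 - a') * b : ℕ) : ℝ) * ((b : ℝ) ^ a)⁻¹ := by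
  have hb' : (b : ℝ) ≠ 0 := Nat.cast_ne_zero.2 hb
  obtain ⟨d, rfl⟩ := Nat.exists_eq_add_of_lt h
  have : a' + d + 1 - 1 - a' = d := by omega
  rw [this]
  push_cast
  field_simp
  ring

theorem continuous_iterInt {b : ℕ} (hb : b ≠ 0) {z : ℕ → ℂ} {l : List ℕ} (h : RootsOn b z l) :
    Continuous (iterInt b z l) := by
  induction l with
  | nil => exact continuous_const
  | cons a l ih =>
    exact intervalIntegral.continuous_primitive (intervalIntegrable_stepChar_mul
      (h.norm_eq hb List.mem_cons_self) fun u v => (ih h.tail).intervalIntegrable u v) 0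

theorem iterInt_periodic {b : ℕ} (hb : b ≠ 0) {z : ℕ → ℂ} {l : List ℕ} (h : RootsOn b z l)
    (hl : l.Pairwise (· < ·)) {a' : ℕ} (ha : ∀ a ∈ l, a' < a) (i : ℕ) (x : ℝ) (hx : 0 ≤ x) :
    iterInt b z l (i * ((b : ℝ) ^ a')⁻¹ + x) = iterInt b z l x := by
  induction l generalizing a' i x with
  | nil => rfl
  | cons a l ih =>
    have hbp : (0 : ℝ) < b := by positivity
    rw [List.pairwise_cons] at hl
    have hz := h a List.mem_cons_self
    rw [inv_pow_eq_mul hb (ha a List.mem_cons_self), ← mul_assoc, ← Nat.cast_mul, ← mul_assoc]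
    exact integral_stepChar_mul_periodic (inv_pos.2 (pow_pos hbp a))
      (h.norm_eq hb List.mem_cons_self) hz.2 hz.1 (continuous_iterInt hb h.tail)
      (fun i x hx => ih h.tail hl.2 hl.1 i x hx) _ hx

/-- The interval is a union of full periods. The factor `1 / (1 - z a)` in `iterMean` is the average
of the partial geometric sums over one period. -/
theorem integral_iterInt {b : ℕ} (hb : b ≠ 0) {z : ℕ → ℂ} {l : List ℕ} (h : RootsOn b z l)
    (hl : l.Pairwise (· < ·)) {a' : ℕ} (ha : ∀ a ∈ l, a' < a) :
    ∫ x in (0 : ℝ)..((b : ℝ) ^ a')⁻¹, iterInt b z l x =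
      (((b : ℝ) ^ a')⁻¹ : ℝ) * iterMean b z l := by
  induction l generalizing a' with
  | nil => simp [iterInt, iterMean]
  | cons a l ih =>
    have hbp : (0 : ℝ) < b := by positivity
    rw [List.pairwise_cons] at hl
    have hz := h a List.mem_cons_self
    rw [inv_pow_eq_mul hb (ha a List.mem_cons_self)]
    refine (integral_integral_stepChar_mul (inv_pos.2 (pow_pos hbp a))
      (h.norm_eq hb List.mem_cons_self) hz.2 hz.1 (continuous_iterInt hb h.tail)
      (fun i x hx => iterInt_periodic hb h.tail hl.2 hl.1 i x hx) _).trans ?_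
    rw [ih h.tail hl.2 hl.1, iterMean]

/-- `iterInt` cell by cell. -/
theorem iterInt_cons_cell {b : ℕ} (hb : b ≠ 0) {z : ℕ → ℂ} {a : ℕ} {l : List ℕ}
    (h : RootsOn b z (a :: l)) (hl : (a :: l).Pairwise (· < ·)) (c : ℕ) {y : ℝ} (hy0 : 0 ≤ y)
    (hy1 : y ≤ ((b : ℝ) ^ a)⁻¹) :
    iterInt b z (a :: l) (c * ((b : ℝ) ^ a)⁻¹ + y) =
      (∑ i ∈ Finset.range c, z a ^ i) * ((((b : ℝ) ^ a)⁻¹ : ℝ) * iterMean b z l) +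
        z a ^ c * ∫ t in (0 : ℝ)..y, iterInt b z l t := by
  have hbp : (0 : ℝ) < b := by positivity
  rw [List.pairwise_cons] at hl
  rw [← integral_iterInt hb h.tail hl.2 hl.1]
  exact integral_stepChar_mul_cell (inv_pos.2 (pow_pos hbp a))
    (h.norm_eq hb List.mem_cons_self) (continuous_iterInt hb h.tail)
    (fun i x hx => iterInt_periodic hb h.tail hl.2 hl.1 i x hx) c hy0 hy1

theorem iterInt_zero (b : ℕ) (z : ℕ → ℂ) (a : ℕ) (l : List ℕ) :
    iterInt b z (a :: l) 0 = 0 := by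
  simp [iterInt]

/-- By periodicity the zero at the origin recurs. These zeros lie at the possible jumps of all
coarser characters, which makes the repeated integration work. -/
theorem iterInt_mul_inv_pow {b : ℕ} (hb : b ≠ 0) {z : ℕ → ℂ} {a : ℕ} {l : List ℕ}
    (h : RootsOn b z (a :: l)) (hl : (a :: l).Pairwise (· < ·)) {a' : ℕ} (ha : a' < a) (i : ℕ) :
    iterInt b z (a :: l) (i * ((b : ℝ) ^ a')⁻¹) = 0 := by
  have := iterInt_periodic hb h hl (a' := a') (by
    intro c hc
    rcases List.mem_cons.1 hc with rfl | hc
    · exact ha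
    · exact ha.trans ((List.pairwise_cons.1 hl).1 c hc)) i 0 le_rfl
  rw [add_zero, iterInt_zero] at this
  exact this

/-! ### Bounds for general `b` -/

/-- `b ^ (-∑ l) / m ^ |l|`. -/
noncomputable def meanBound (b : ℕ) (m : ℝ) (l : List ℕ) : ℝ := ((b : ℝ) ^ l.sum)⁻¹ / m ^ l.length

theorem meanBound_cons (b : ℕ) (m : ℝ) (a : ℕ) (l : List ℕ) :
    meanBound b m (a :: l) = ((b : ℝ) ^ a)⁻¹ * meanBound b m l / m := by
  simp only [meanBound, List.sum_cons, List.length_cons, pow_add, pow_one, mul_inv, div_eq_mul_inv]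
  ring

theorem meanBound_nonneg (b : ℕ) {m : ℝ} (hm : 0 < m) (l : List ℕ) : 0 ≤ meanBound b m l := by
  unfold meanBound; positivity

theorem norm_iterMean_le {b : ℕ} {z : ℕ → ℂ} {m : ℝ} (hm : 0 < m) {l : List ℕ}
    (hmz : ∀ a ∈ l, m ≤ ‖1 - z a‖) : ‖iterMean b z l‖ ≤ meanBound b m l := by
  induction l with
  | nil => simp [iterMean, meanBound]
  | cons a l ih =>
    have h1 := ih fun c hc => hmz c (List.mem_cons_of_mem _ hc)
    have h2 := hmz a List.mem_cons_self
    rw [meanBound_cons, iterMean, norm_div, norm_mul, Complex.norm_real,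
      Real.norm_of_nonneg (by positivity)]
    have := meanBound_nonneg b hm l
    gcongr

theorem norm_geom_sum_le {ζ : ℂ} {m M : ℝ} (hm : 0 < m) (h1 : ζ ≠ 1) (hmz : m ≤ ‖1 - ζ‖)
    (hMz : ∀ c : ℕ, ‖1 - ζ ^ c‖ ≤ M) (c : ℕ) : ‖∑ i ∈ Finset.range c, ζ ^ i‖ ≤ M / m := by
  rw [geom_sum_eq_div h1, norm_div]
  have := hMz c
  have : 0 ≤ M := (norm_nonneg _).trans this
  gcongr

/-- `m ∑_{i < n} (M / b) ^ i`. -/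
noncomputable def primConst (b : ℕ) (m M : ℝ) (n : ℕ) : ℝ := m * ∑ i ∈ Finset.range n, (M / b) ^ i

theorem primConst_succ (b : ℕ) (m M : ℝ) (n : ℕ) :
    primConst b m M (n + 1) = m + M / b * primConst b m M n := by
  simp only [primConst, Finset.sum_range_succ', Finset.mul_sum, pow_zero, pow_succ]
  rw [add_comm, mul_add, mul_one, Finset.mul_sum]
  congr 1
  exact Finset.sum_congr rfl fun i _ => by ring

/-- The primitive of `iterInt` on the initial segment of length `b ^ (-a')`. -/
theorem norm_integral_iterInt_le {b : ℕ} (hb : b ≠ 0) {z : ℕ → ℂ} {m M : ℝ} (hm : 0 < m)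
    (hM : 0 ≤ M) {l : List ℕ} (h : RootsOn b z l) (hl : l.Pairwise (· < ·))
    (hmz : ∀ a ∈ l, m ≤ ‖1 - z a‖) (hMz : ∀ a ∈ l, ∀ c : ℕ, ‖1 - z a ^ c‖ ≤ M)
    {a' : ℕ} (ha : ∀ a ∈ l, a' < a) {y : ℝ} (hy0 : 0 ≤ y) (hy1 : y ≤ ((b : ℝ) ^ a')⁻¹) :
    ‖∫ t in (0 : ℝ)..y, iterInt b z l t‖ ≤
      ((b : ℝ) ^ a')⁻¹ * meanBound b m l * primConst b m M (l.length + 1) / m := by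
  induction l generalizing a' y with
  | nil =>
    simp only [iterInt, meanBound, primConst]
    simp [hm.ne', abs_of_nonneg hy0]
    exact hy1
  | cons a l ih =>
    have hbp : (0 : ℝ) < b := by positivity
    have hl' := List.pairwise_cons.1 hl
    have hz := h a List.mem_cons_self
    have hn := h.norm_eq hb List.mem_cons_self
    have hmz' : ∀ c ∈ l, m ≤ ‖1 - z c‖ := fun c hc => hmz c (List.mem_cons_of_mem _ hc)
    have hma := hmz a List.mem_cons_self
    have hMa := hMz a List.mem_cons_self
    have hU := continuous_iterInt hb h.tail
    have hprim := intervalIntegral.continuous_primitive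
      (fun u v => hU.intervalIntegrable (μ := volume) u v) 0
    have hg : ∀ w, 0 ≤ w → w ≤ ((b : ℝ) ^ a)⁻¹ → ‖∫ t in (0 : ℝ)..w, iterInt b z l t‖ ≤
        meanBound b m (a :: l) * primConst b m M (l.length + 1) := by
      intro w hw0 hw1
      refine (ih h.tail hl'.2 hmz' (fun c hc => hMz c (List.mem_cons_of_mem _ hc))
        hl'.1 hw0 hw1).trans_eq ?_
      rw [meanBound_cons]
      ring
    have hJ := norm_iterMean_le (b := b) hm hmz
    have hQ := meanBound_nonneg b hm (a :: l)
    have hC : 0 ≤ primConst b m M (l.length + 1) := by unfold primConst; positivity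
    have hJdef : iterMean b z (a :: l) =
        (((b : ℝ) ^ a)⁻¹ : ℝ) * iterMean b z l / (1 - z a) := rfl
    have hI := integral_iterInt hb h.tail hl'.2 hl'.1
    have hperU : ∀ (i : ℕ) (x : ℝ), 0 ≤ x →
        iterInt b z l (i * ((b : ℝ) ^ a)⁻¹ + x) = iterInt b z l x :=
      fun i x hx => iterInt_periodic hb h.tail hl'.2 hl'.1 i x hx
    have haa := ha a List.mem_cons_self
    rw [inv_pow_eq_mul hb haa] at hy1 ⊢
    set N := b ^ (a - 1 - a') with hN
    have hN1 : (1 : ℝ) ≤ N := by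
      exact_mod_cast Nat.one_le_pow _ _ (Nat.pos_of_ne_zero hb)
    have hLpos : 0 < ((b : ℝ) ^ a)⁻¹ := inv_pos.2 (pow_pos hbp a)
    set L := ((b : ℝ) ^ a)⁻¹ with hL
    obtain ⟨c, w, hw0, hw1, rfl⟩ := exists_cell hLpos hy0
    set J := iterMean b z (a :: l) with hJ_def
    set H := ∫ x in (0 : ℝ)..L, ∫ t in (0 : ℝ)..x, iterInt b z l t with hH
    set u := ∫ x in (0 : ℝ)..w, ∫ t in (0 : ℝ)..x, iterInt b z l t with hu
    set Q := meanBound b m (a :: l) with hQdef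
    set C := primConst b m M (l.length + 1) with hCdef
    set S : ℕ → ℂ := fun c => ∑ i ∈ Finset.range c, z a ^ i with hS
    set F : ℕ → ℂ := fun c => ∑ i ∈ Finset.range c, (1 - z a ^ i) with hF
    have hSI : ∀ i, S i * ∫ t in (0 : ℝ)..L, iterInt b z l t = J * (1 - z a ^ i) := by
      intro i
      rw [hI, hS, hJdef]
      simp only
      rw [geom_sum_eq_div hz.1]
      ring
    -- The terms are grouped as linear interpolations in `w` between the indices `c` and `c + 1`: a
    -- drift carried by the mean `J`, and an oscillation whose pieces `H - u` and `u` have weights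
    -- `L - w` and `w`. Bounding `S c * H` and `z a ^ c * u` separately would lose a term.
    have hdecomp : ∫ t in (0 : ℝ)..(c * L + w), iterInt b z (a :: l) t =
        J * ((L - w : ℝ) * F c + w * F (c + 1)) + (S c * (H - u) + S (c + 1) * u) := by
      refine (integral_integral_stepChar_mul_cell hLpos hn hU hperU c hw0 hw1.le).trans ?_
      change ∑ i ∈ Finset.range c, ((L : ℂ) * (S i * ∫ t in (0 : ℝ)..L, iterInt b z l t) +
        z a ^ i * H) + (w * (S c * ∫ t in (0 : ℝ)..L, iterInt b z l t) + z a ^ c * u) = _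
      simp only [hSI, Finset.sum_add_distrib, ← Finset.mul_sum, ← Finset.sum_mul]
      change L * (J * F c) + S c * H + (w * (J * (1 - z a ^ c)) + z a ^ c * u) = _
      rw [show S (c + 1) = S c + z a ^ c from Finset.sum_range_succ _ _,
        show F (c + 1) = F c + (1 - z a ^ c) from Finset.sum_range_succ _ _]
      push_cast
      ring
    have hub : ‖u‖ ≤ Q * C * w := by
      have := intervalIntegral.norm_integral_le_of_norm_le_const (a := 0) (b := w)
        (f := fun x => ∫ t in (0 : ℝ)..x, iterInt b z l t) (C := Q * C) (fun x hx => by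
          rw [Set.uIoc_of_le hw0] at hx
          exact hg x hx.1.le (hx.2.trans hw1.le))
      rwa [sub_zero, abs_of_nonneg hw0] at this
    have hHu : ‖H - u‖ ≤ Q * C * (L - w) := by
      rw [hH, hu, intervalIntegral.integral_interval_sub_left (hprim.intervalIntegrable _ _)
        (hprim.intervalIntegrable _ _)]
      have := intervalIntegral.norm_integral_le_of_norm_le_const (a := w) (b := L)
        (f := fun x => ∫ t in (0 : ℝ)..x, iterInt b z l t) (C := Q * C) (fun x hx => by
          rw [Set.uIoc_of_le hw1.le] at hx
          exact hg x (hw0.trans hx.1.le) hx.2)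
      rwa [abs_of_nonneg (by linarith)] at this
    have hcle : c ≤ N * b := by
      have : (c : ℝ) * L ≤ (N * b : ℕ) * L := by linarith
      exact_mod_cast le_of_mul_le_mul_right this hLpos
    have hF1 : ‖F c‖ ≤ (N * b : ℕ) := norm_sum_one_sub_pow_le hn hz.1 hz.2 N hcle
    -- The index `c + 1` can exceed `N * b` only at the right endpoint, where its weight `w` is
    -- zero.
    have hF2 : w * ‖F (c + 1)‖ ≤ w * (N * b : ℕ) := by
      rcases hcle.eq_or_lt with hc | hc
      · have : w = 0 := by
          rw [hc] at hy1
          linarith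
        simp [this]
      · exact mul_le_mul_of_nonneg_left (norm_sum_one_sub_pow_le hn hz.1 hz.2 N hc) hw0
    have hFb : ‖((L - w : ℝ) : ℂ) * F c + w * F (c + 1)‖ ≤ L * (N * b : ℕ) := by
      refine (norm_add_le _ _).trans ?_
      rw [norm_mul, norm_mul, Complex.norm_real, Complex.norm_real,
        Real.norm_of_nonneg (by linarith), Real.norm_of_nonneg hw0]
      have : (L - w) * ‖F c‖ ≤ (L - w) * (N * b : ℕ) :=
        mul_le_mul_of_nonneg_left hF1 (by linarith)
      linarith
    have hSb := norm_geom_sum_le hm hz.1 hma hMa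
    have hSs : ‖S c * (H - u) + S (c + 1) * u‖ ≤ M / m * (Q * C * L) := by
      refine (norm_add_le _ _).trans ?_
      rw [norm_mul, norm_mul]
      have e1 : ‖S c‖ * ‖H - u‖ ≤ M / m * (Q * C * (L - w)) :=
        mul_le_mul (hSb c) hHu (norm_nonneg _) (by positivity)
      have e2 : ‖S (c + 1)‖ * ‖u‖ ≤ M / m * (Q * C * w) :=
        mul_le_mul (hSb (c + 1)) hub (norm_nonneg _) (by positivity)
      linarith
    rw [hdecomp, List.length_cons, primConst_succ, ← hCdef]
    refine (norm_add_le _ _).trans ?_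
    rw [norm_mul]
    have e1 : ‖J‖ * ‖((L - w : ℝ) : ℂ) * F c + w * F (c + 1)‖ ≤ Q * (L * (N * b : ℕ)) :=
      mul_le_mul hJ hFb (norm_nonneg _) hQ
    -- Since `N * L = b ^ (-a') / b`, inserting the factor `N ≥ 1` brings the oscillation to the
    -- form `M / b` times the previous constant.
    have e2 : M / m * (Q * C * L) ≤ N * (M / m * (Q * C * L)) :=
      le_mul_of_one_le_left (by positivity) hN1
    refine (add_le_add e1 (hSs.trans e2)).trans_eq ?_
    push_cast
    field_simp

/-- The sup bound for `iterInt`. -/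
theorem norm_iterInt_cons_le {b : ℕ} (hb : b ≠ 0) {z : ℕ → ℂ} {m M : ℝ} (hm : 0 < m)
    (hM : 0 ≤ M) {a : ℕ} {l : List ℕ} (h : RootsOn b z (a :: l))
    (hl : (a :: l).Pairwise (· < ·)) (hmz : ∀ c ∈ a :: l, m ≤ ‖1 - z c‖)
    (hMz : ∀ a' ∈ a :: l, ∀ c : ℕ, ‖1 - z a' ^ c‖ ≤ M) {x : ℝ} (hx : 0 ≤ x) :
    ‖iterInt b z (a :: l) x‖ ≤
      meanBound b m (a :: l) * (M + primConst b m M (l.length + 1)) := by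
  have hbp : (0 : ℝ) < b := by positivity
  have hLpos : 0 < ((b : ℝ) ^ a)⁻¹ := inv_pos.2 (pow_pos hbp a)
  have hl' := List.pairwise_cons.1 hl
  have hz := h a List.mem_cons_self
  have hmz' : ∀ c ∈ l, m ≤ ‖1 - z c‖ := fun c hc => hmz c (List.mem_cons_of_mem _ hc)
  obtain ⟨c, y, hy0, hy1, rfl⟩ := exists_cell hLpos hx
  rw [iterInt_cons_cell hb h hl c hy0 hy1.le]
  refine (norm_add_le _ _).trans ?_
  rw [norm_mul, norm_mul, norm_mul, norm_pow, h.norm_eq hb List.mem_cons_self, one_pow, one_mul,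
    Complex.norm_real, Real.norm_of_nonneg hLpos.le]
  have e1 : ‖∑ i ∈ Finset.range c, z a ^ i‖ * (((b : ℝ) ^ a)⁻¹ * ‖iterMean b z l‖) ≤
      M / m * (((b : ℝ) ^ a)⁻¹ * meanBound b m l) := by
    refine mul_le_mul (norm_geom_sum_le hm hz.1 (hmz a List.mem_cons_self)
      (hMz a List.mem_cons_self) c) ?_ (by positivity) (by positivity)
    exact mul_le_mul_of_nonneg_left (norm_iterMean_le hm hmz') hLpos.le
  have e2 := norm_integral_iterInt_le hb hm hM h.tail hl'.2 hmz'
    (fun c hc => hMz c (List.mem_cons_of_mem _ hc)) hl'.1 hy0 hy1.le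
  refine (add_le_add e1 e2).trans_eq ?_
  rw [meanBound_cons]
  ring

/-! ### Positivity for `b = 2` -/

theorem iterMean_two {z : ℕ → ℂ} {l : List ℕ} (hz : ∀ a ∈ l, z a = -1) :
    iterMean 2 z l = (meanBound 2 2 l : ℝ) := by
  induction l with
  | nil => simp [iterMean, meanBound]
  | cons a l ih =>
    rw [iterMean, ih fun c hc => hz c (List.mem_cons_of_mem _ hc), hz a List.mem_cons_self,
      meanBound_cons]
    push_cast
    norm_num

theorem rootsOn_two {z : ℕ → ℂ} {l : List ℕ} (hz : ∀ a ∈ l, z a = -1) : RootsOn 2 z l := by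
  intro a ha
  rw [hz a ha]
  norm_num

/-- For `b = 2` the iterated integrals are real and nonnegative, and at most twice their mean. -/
theorem iterInt_two {z : ℕ → ℂ} {l : List ℕ} (hz : ∀ a ∈ l, z a = -1)
    (hl : l.Pairwise (· < ·)) :
    ∃ w : ℝ → ℝ, Continuous w ∧ ∀ x, 0 ≤ x → iterInt 2 z l x = w x ∧ 0 ≤ w x ∧
      w x ≤ 2 ^ min 1 l.length * meanBound 2 2 l := by
  induction l with
  | nil => exact ⟨fun _ => 1, continuous_const, fun x _ => by simp [iterInt, meanBound]⟩
  | cons a l ih =>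
    have hroots := rootsOn_two hz
    have hzl : ∀ c ∈ l, z c = -1 := fun c hc => hz c (List.mem_cons_of_mem _ hc)
    have hl' := List.pairwise_cons.1 hl
    obtain ⟨w, hwc, hw⟩ := ih hzl hl'.2
    refine ⟨fun x => (iterInt 2 z (a :: l) x).re,
      Complex.continuous_re.comp (continuous_iterInt two_ne_zero hroots), fun x hx => ?_⟩
    have hLpos : (0 : ℝ) < (((2 : ℕ) : ℝ) ^ a)⁻¹ := by positivity
    have hP : ∀ y, 0 ≤ y → ∫ t in (0 : ℝ)..y, iterInt 2 z l t = (∫ t in (0 : ℝ)..y, w t : ℝ) := by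
      intro y hy
      rw [← intervalIntegral.integral_ofReal]
      exact intervalIntegral.integral_congr_Ioo_of_le hy fun t ht => (hw t ht.1.le).1
    have hI := integral_iterInt two_ne_zero hroots.tail hl'.2 hl'.1
    have hIQ : ∫ t in (0 : ℝ)..(((2 : ℕ) : ℝ) ^ a)⁻¹, w t =
        2 ^ min 1 (a :: l).length * meanBound 2 2 (a :: l) := by
      have := (hP _ hLpos.le).symm.trans hI
      rw [iterMean_two hzl] at this
      rw [meanBound_cons, List.length_cons, min_eq_left (by omega), pow_one,
        mul_div_cancel₀ _ two_ne_zero]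
      exact_mod_cast this
    beta_reduce
    obtain ⟨c, y, hy0, hy1, rfl⟩ := exists_cell hLpos hx
    have hint : ∀ u v, IntervalIntegrable w volume u v := fun u v => hwc.intervalIntegrable u v
    have e1 : 0 ≤ ∫ t in (0 : ℝ)..y, w t :=
      intervalIntegral.integral_nonneg hy0 fun t ht => (hw t ht.1).2.1
    have e2 : 0 ≤ ∫ t in y..(((2 : ℕ) : ℝ) ^ a)⁻¹, w t :=
      intervalIntegral.integral_nonneg hy1.le fun t ht => (hw t (hy0.trans ht.1)).2.1
    have e3 := intervalIntegral.integral_add_adjacent_intervals (hint 0 y)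
      (hint y (((2 : ℕ) : ℝ) ^ a)⁻¹)
    rw [iterInt_cons_cell two_ne_zero hroots hl c hy0 hy1.le, ← hI, hP _ hLpos.le, hP y hy0,
      hz a List.mem_cons_self, neg_one_geom_sum, ← hIQ]
    -- On even cells the value is the primitive `P y`, on odd cells `I - P y`; both lie in `[0, I]`,
    -- and `I` is twice the new mean.
    rcases Nat.even_or_odd c with hc | hc
    · rw [if_pos hc, hc.neg_one_pow]
      simp only [zero_mul, one_mul, zero_add, Complex.ofReal_re, true_and]
      exact ⟨e1, by linarith⟩
    · rw [if_neg (Nat.not_even_iff_odd.2 hc), hc.neg_one_pow, one_mul, neg_one_mul,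
        ← sub_eq_add_neg, ← Complex.ofReal_sub, Complex.ofReal_re]
      exact ⟨rfl, by linarith, by linarith⟩

/-! ### The kernels obtained from a Walsh function by repeated integration -/

/-- The product of the step characters at the positions in `l`. -/
noncomputable def charProd (b : ℕ) (z : ℕ → ℂ) (l : List ℕ) (t : ℝ) : ℂ :=
  (l.map fun a => stepChar ((b : ℝ) ^ a)⁻¹ (z a) t).prod

theorem charProd_cons (b : ℕ) (z : ℕ → ℂ) (a : ℕ) (l : List ℕ) (t : ℝ) :
    charProd b z (a :: l) t = stepChar ((b : ℝ) ^ a)⁻¹ (z a) t * charProd b z l t := by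
  simp [charProd]

theorem measurable_charProd (b : ℕ) (z : ℕ → ℂ) (l : List ℕ) : Measurable (charProd b z l) := by
  induction l with
  | nil => exact measurable_const
  | cons a l ih =>
    simp only [funext (charProd_cons b z a l)]
    exact (measurable_stepChar _ _).mul ih

theorem norm_charProd {b : ℕ} (hb : b ≠ 0) {z : ℕ → ℂ} {l : List ℕ} (h : RootsOn b z l) (t : ℝ) :
    ‖charProd b z l t‖ = 1 := by
  induction l with
  | nil => simp [charProd]
  | cons a l ih =>
    rw [charProd_cons, norm_mul, norm_stepChar _ (h.norm_eq hb List.mem_cons_self), ih h.tail,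
      one_mul]

theorem charProd_continuousWithinAt {b : ℕ} (hb : b ≠ 0) (z : ℕ → ℂ) (l : List ℕ) {x : ℝ}
    (hx : 0 ≤ x) : ContinuousWithinAt (charProd b z l) (Set.Ioi x) x := by
  induction l with
  | nil => exact continuousWithinAt_const
  | cons a l ih =>
    simp only [funext (charProd_cons b z a l)]
    have hbp : (0 : ℝ) < b := by positivity
    exact (stepChar_continuousWithinAt (inv_pos.2 (pow_pos hbp a)) _ hx).mul ih

theorem stepChar_inv_pow_cell {b : ℕ} (hb : b ≠ 0) (ζ : ℂ) {a' a : ℕ} (h : a' ≤ a) (i : ℕ)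
    {y : ℝ} (hy0 : 0 ≤ y) (hy1 : y < ((b : ℝ) ^ a)⁻¹) :
    stepChar ((b : ℝ) ^ a')⁻¹ ζ (i * ((b : ℝ) ^ a)⁻¹ + y) =
      stepChar ((b : ℝ) ^ a')⁻¹ ζ (i * ((b : ℝ) ^ a)⁻¹) := by
  have hbp : (0 : ℝ) < b := by positivity
  -- The coarse floor is obtained from the fine one by integer division by `b ^ (a - a')`, so it
  -- depends only on the fine cell.
  have key : ∀ t : ℝ, t / ((b : ℝ) ^ a')⁻¹ = t * (b : ℝ) ^ a / ((b ^ (a - a') : ℕ) : ℝ) := by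
    intro t
    push_cast
    rw [div_inv_eq_mul, eq_div_iff (by positivity), mul_assoc, ← pow_add,
      Nat.add_sub_cancel' h]
  have hbne : (b : ℝ) ^ a ≠ 0 := by positivity
  have hf : ⌊(i * ((b : ℝ) ^ a)⁻¹ + y) * (b : ℝ) ^ a⌋₊ = i := by
    rw [add_mul, inv_mul_cancel_right₀ hbne, Nat.floor_eq_iff (by positivity)]
    have : y * (b : ℝ) ^ a < 1 := by
      rwa [← lt_div_iff₀ (by positivity), one_div]
    constructor
    · have : 0 ≤ y * (b : ℝ) ^ a := by positivity
      linarith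
    · linarith
  rw [stepChar, stepChar, key, key, Nat.floor_div_natCast, Nat.floor_div_natCast, hf,
    inv_mul_cancel_right₀ hbne, Nat.floor_natCast]

theorem charProd_cell {b : ℕ} (hb : b ≠ 0) (z : ℕ → ℂ) {l : List ℕ} {a : ℕ}
    (h : ∀ a' ∈ l, a' ≤ a) (i : ℕ) {y : ℝ} (hy0 : 0 ≤ y) (hy1 : y < ((b : ℝ) ^ a)⁻¹) :
    charProd b z l (i * ((b : ℝ) ^ a)⁻¹ + y) = charProd b z l (i * ((b : ℝ) ^ a)⁻¹) := by
  unfold charProd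
  congr 1
  exact List.map_congr_left fun a' ha' => stepChar_inv_pow_cell hb _ (h a' ha') i hy0 hy1

/-- The `r`-fold integral of the product of step characters along the decreasing list `l`. -/
noncomputable def charKernel (b : ℕ) (z : ℕ → ℂ) (l : List ℕ) (r : ℕ) (t : ℝ) : ℂ :=
  charProd b z (l.drop r) t * iterInt b z (l.take r).reverse t

theorem RootsOn.mono {b : ℕ} {z : ℕ → ℂ} {l l' : List ℕ} (h : RootsOn b z l) (hl : l' ⊆ l) :
    RootsOn b z l' := fun a ha => h a (hl ha)

theorem RootsOn.reverse_take {b : ℕ} {z : ℕ → ℂ} {l : List ℕ} (h : RootsOn b z l) (r : ℕ) :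
    RootsOn b z (l.take r).reverse :=
  h.mono fun _ ha => List.mem_of_mem_take (List.mem_reverse.1 ha)

theorem pairwise_reverse_take {l : List ℕ} (hl : l.Pairwise (· > ·)) (r : ℕ) :
    (l.take r).reverse.Pairwise (· < ·) :=
  List.pairwise_reverse.2 (hl.sublist (List.take_sublist r l))

theorem norm_charKernel {b : ℕ} (hb : b ≠ 0) {z : ℕ → ℂ} {l : List ℕ} (h : RootsOn b z l)
    (r : ℕ) (t : ℝ) : ‖charKernel b z l r t‖ = ‖iterInt b z (l.take r).reverse t‖ := by
  rw [charKernel, norm_mul, norm_charProd hb (h.mono (List.drop_subset r l)), one_mul]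

theorem measurable_charKernel {b : ℕ} (hb : b ≠ 0) {z : ℕ → ℂ} {l : List ℕ} (h : RootsOn b z l)
    (r : ℕ) : Measurable (charKernel b z l r) :=
  (measurable_charProd _ _ _).mul (continuous_iterInt hb (h.reverse_take r)).measurable

theorem charKernel_continuousWithinAt {b : ℕ} (hb : b ≠ 0) {z : ℕ → ℂ} {l : List ℕ}
    (h : RootsOn b z l) (r : ℕ) {x : ℝ} (hx : 0 ≤ x) :
    ContinuousWithinAt (charKernel b z l r) (Set.Ioi x) x :=
  (charProd_continuousWithinAt hb z _ hx).mul
    (continuous_iterInt hb (h.reverse_take r)).continuousWithinAt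

theorem intervalIntegrable_charKernel {b : ℕ} (hb : b ≠ 0) {z : ℕ → ℂ} {l : List ℕ}
    (h : RootsOn b z l) (r : ℕ) (u v : ℝ) :
    IntervalIntegrable (charKernel b z l r) volume u v := by
  have hc := continuous_iterInt hb (h.reverse_take r)
  refine (hc.intervalIntegrable u v).mono_fun
    (measurable_charKernel hb h r).aestronglyMeasurable (Filter.Eventually.of_forall fun t => ?_)
  exact (norm_charKernel hb h r t).le

theorem reverse_take_succ {l : List ℕ} {r : ℕ} (hr : r < l.length) :
    (l.take (r + 1)).reverse = l[r] :: (l.take r).reverse := by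
  rw [List.take_succ_eq_append_getElem hr, List.reverse_append]
  rfl

theorem charKernel_succ_one {b : ℕ} (hb : b ≠ 0) {z : ℕ → ℂ} {l : List ℕ} (h : RootsOn b z l)
    (hl : l.Pairwise (· > ·)) (hpos : ∀ a ∈ l, 1 ≤ a) {r : ℕ} (hr : r < l.length) :
    charKernel b z l (r + 1) 1 = 0 := by
  have h1 := h.reverse_take (r + 1)
  have h2 := pairwise_reverse_take hl (r + 1)
  rw [charKernel]
  rw [reverse_take_succ hr] at h1 h2 ⊢
  have := iterInt_mul_inv_pow hb h1 h2 (a' := 0) (hpos _ (List.getElem_mem hr)) 1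
  simp only [Nat.cast_one, pow_zero, inv_one, mul_one] at this
  rw [this, mul_zero]

/-- Each kernel is the primitive of the previous one. -/
theorem charKernel_succ {b : ℕ} (hb : b ≠ 0) {z : ℕ → ℂ} {l : List ℕ} (h : RootsOn b z l)
    (hl : l.Pairwise (· > ·)) (hpos : ∀ a ∈ l, 1 ≤ a) {r : ℕ} (hr : r < l.length)
    {x : ℝ} (hx : 0 ≤ x) :
    charKernel b z l (r + 1) x = ∫ t in (0 : ℝ)..x, charKernel b z l r t := by
  have hbp : (0 : ℝ) < b := by positivity
  have h1 := h.reverse_take (r + 1)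
  have h2 := pairwise_reverse_take hl (r + 1)
  rw [reverse_take_succ hr] at h1 h2
  have hdrop : l.drop r = l[r] :: l.drop (r + 1) := List.drop_eq_getElem_cons hr
  have hlt : ∀ a' ∈ l.drop (r + 1), a' ≤ l[r] - 1 := by
    have h3 := hl.sublist (List.drop_sublist r l)
    rw [hdrop, List.pairwise_cons] at h3
    exact fun a' ha' => Nat.le_sub_one_of_lt (h3.1 a' ha')
  have ha1 : 1 ≤ l[r] := hpos _ (List.getElem_mem hr)
  set a := l[r] with ha
  have hPpos : 0 < ((b : ℝ) ^ (a - 1))⁻¹ := inv_pos.2 (pow_pos hbp _)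
  have hvan : ∀ i : ℕ, iterInt b z (a :: (l.take r).reverse) (i * ((b : ℝ) ^ (a - 1))⁻¹) = 0 :=
    fun i => iterInt_mul_inv_pow hb h1 h2 (by omega) i
  set P := ((b : ℝ) ^ (a - 1))⁻¹ with hP
  have hint : ∀ u v, IntervalIntegrable (fun t => stepChar ((b : ℝ) ^ a)⁻¹ (z a) t *
      iterInt b z (l.take r).reverse t) volume u v :=
    intervalIntegrable_stepChar_mul (h1.norm_eq hb List.mem_cons_self)
      fun u v => (continuous_iterInt hb (h.reverse_take r)).intervalIntegrable u v
  have key : ∀ (i : ℕ) (w : ℝ), 0 ≤ w → w ≤ P →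
      ∫ y in (0 : ℝ)..w, charKernel b z l r (i * P + y) =
        charProd b z (l.drop (r + 1)) (i * P) *
          iterInt b z (a :: (l.take r).reverse) (i * P + w) := by
    intro i w hw0 hw1
    have e1 : ∫ y in (0 : ℝ)..w, charKernel b z l r (i * P + y) =
        ∫ y in (0 : ℝ)..w, charProd b z (l.drop (r + 1)) (i * P) *
          (stepChar ((b : ℝ) ^ a)⁻¹ (z a) (i * P + y) *
            iterInt b z (l.take r).reverse (i * P + y)) := by
      refine intervalIntegral.integral_congr_Ioo_of_le hw0 fun y hy => ?_
      rw [charKernel, hdrop, charProd_cons,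
        charProd_cell hb z hlt i hy.1.le (hy.2.trans_le hw1)]
      ring
    rw [e1, intervalIntegral.integral_const_mul,
      intervalIntegral.integral_comp_add_left (fun t => stepChar ((b : ℝ) ^ a)⁻¹ (z a) t *
        iterInt b z (l.take r).reverse t), add_zero]
    congr 1
    have e2 := intervalIntegral.integral_add_adjacent_intervals (hint 0 (i * P))
      (hint (i * P) (i * P + w))
    have e3 := hvan i
    simp only [iterInt] at e3 ⊢
    rw [e3, zero_add] at e2
    exact e2
  obtain ⟨c, y, hy0, hy1, rfl⟩ := exists_cell hPpos hx
  -- Every complete cell of length `P` contributes zero, so only the last partial cell remains.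
  rw [integral_eq_sum_cells (intervalIntegrable_charKernel hb h r), key c y hy0 hy1.le,
    Finset.sum_eq_zero, zero_add, charKernel, charProd_cell hb z hlt c hy0 hy1,
    reverse_take_succ hr]
  intro i _
  rw [key i P hPpos.le le_rfl]
  have := hvan (i + 1)
  rw [Nat.cast_add, Nat.cast_one, add_mul, one_mul] at this
  rw [this, mul_zero]

/-! ### The digits of `k` -/

/-- The root of unity `ω_b ^ (-κ)` attached to the digit `κ` of `k` at position `a`. -/
noncomputable def digitRoot (b k a : ℕ) : ℂ := conj (omega b) ^ (Nat.digits b k).getD (a - 1) 0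

theorem pairwise_positions (b k : ℕ) : (positions b k).Pairwise (· > ·) := by
  unfold positions
  rw [List.pairwise_reverse, List.pairwise_map]
  refine (List.pairwise_lt_range.sublist List.filter_sublist).imp ?_
  intro a b h
  omega

theorem mem_positions {b k a : ℕ} (h : a ∈ positions b k) :
    1 ≤ a ∧ (Nat.digits b k).getD (a - 1) 0 ≠ 0 := by
  simp only [positions, List.mem_reverse, List.mem_map, List.mem_filter] at h
  obtain ⟨i, ⟨_, hi⟩, rfl⟩ := h
  exact ⟨by omega, by simpa using hi⟩

theorem isPrimitiveRoot_conj_omega {b : ℕ} (hb : b ≠ 0) : IsPrimitiveRoot (conj (omega b)) b :=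
  (Complex.isPrimitiveRoot_exp b hb).map_of_injective (f := starRingEnd ℂ) star_injective

theorem getD_digits_lt {b : ℕ} (hb : 2 ≤ b) (k i : ℕ) : (Nat.digits b k).getD i 0 < b := by
  rcases lt_or_ge i (Nat.digits b k).length with h | h
  · rw [List.getD_eq_getElem _ _ h]
    exact Nat.digits_lt_base hb (List.getElem_mem h)
  · rw [List.getD_eq_default _ _ h]
    omega

theorem rootsOn_positions {b : ℕ} (hb : 2 ≤ b) (k : ℕ) :
    RootsOn b (digitRoot b k) (positions b k) := by
  intro a ha
  have hp := isPrimitiveRoot_conj_omega (b := b) (by omega)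
  constructor
  · exact hp.pow_ne_one_of_pos_of_lt (mem_positions ha).2 (getD_digits_lt hb k _)
  · rw [digitRoot, ← pow_mul, mul_comm, pow_mul, hp.pow_eq_one, one_pow]

theorem conj_wal {b : ℕ} [NeZero b] (k : ℕ) (x : ℝ) :
    conj (wal b k x) = charProd b (digitRoot b k) (positions b k) x := by
  have hfil : ∀ (l : List ℕ) (g : ℕ → ℂ) (p : ℕ → Bool), (∀ i, p i = false → g i = 1) →
      ((l.filter p).map g).prod = (l.map g).prod := by
    intro l g p hp
    induction l with
    | nil => rfl
    | cons i l ih =>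
      cases hi : p i
      · simp [hi, hp i hi, ih]
      · simp [hi, ih]
  have hroot := (isPrimitiveRoot_conj_omega (NeZero.ne b)).pow_eq_one
  rw [wal, map_pow, ← Finset.prod_pow_eq_pow_sum, charProd, positions, List.map_reverse,
    List.prod_reverse, List.map_map, hfil]
  · change _ = ∏ i ∈ Finset.range (Nat.digits b k).length,
      stepChar ((b : ℝ) ^ (i + 1))⁻¹ (digitRoot b k (i + 1)) x
    refine Finset.prod_congr rfl fun i _ => ?_
    rw [pow_mul, stepChar, digitRoot, add_tsub_cancel_right, div_inv_eq_mul]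
    have hpow : (conj (omega b) ^ (Nat.digits b k).getD i 0) ^ b = 1 := by
      rw [← pow_mul, mul_comm, pow_mul, hroot, one_pow]
    -- `stepChar` uses the unreduced integer `⌊x b ^ (i + 1)⌋`, whose residue modulo `b` is the
    -- digit.
    rw [pow_eq_pow_mod ⌊x * (b : ℝ) ^ (i + 1)⌋₊ hpow]
    rfl
  · intro i hi
    have hi' : (Nat.digits b k).getD i 0 = 0 := by simpa using hi
    simp only [Function.comp, stepChar, digitRoot, add_tsub_cancel_right, hi', pow_zero, one_pow]

/-! ### The extremal distances `m_b` and `M_b` -/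

theorem norm_conj_omega_pow (b c : ℕ) (hb : b ≠ 0) : ‖conj (omega b) ^ c‖ = 1 := by
  rw [norm_pow, Complex.norm_eq_one_of_pow_eq_one
    (isPrimitiveRoot_conj_omega hb).pow_eq_one hb, one_pow]

theorem mMin_le {b c : ℕ} (h1 : 1 ≤ c) (h2 : c ≤ b - 1) :
    mMin b ≤ ‖1 - conj (omega b) ^ c‖ :=
  ciInf_le (Set.finite_range _).bddBelow (⟨c, Finset.mem_Icc.2 ⟨h1, h2⟩⟩ : Finset.Icc 1 (b - 1))

theorem le_mMax {b c : ℕ} (h1 : 1 ≤ c) (h2 : c ≤ b - 1) :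
    ‖1 - conj (omega b) ^ c‖ ≤ mMax b :=
  le_ciSup (f := fun c : Finset.Icc 1 (b - 1) => ‖1 - conj (omega b) ^ (c : ℕ)‖)
    (Set.finite_range _).bddAbove ⟨c, Finset.mem_Icc.2 ⟨h1, h2⟩⟩

theorem nonempty_Icc {b : ℕ} (hb : 2 ≤ b) : Nonempty (Finset.Icc 1 (b - 1)) :=
  ⟨⟨1, Finset.mem_Icc.2 ⟨le_rfl, by omega⟩⟩⟩

theorem mMin_pos {b : ℕ} (hb : 2 ≤ b) : 0 < mMin b := by
  have := nonempty_Icc hb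
  obtain ⟨⟨c, hc⟩, h⟩ := exists_eq_ciInf_of_finite
    (f := fun c : Finset.Icc 1 (b - 1) => ‖1 - conj (omega b) ^ (c : ℕ)‖)
  rw [mMin, ← h]
  rw [Finset.mem_Icc] at hc
  have := (isPrimitiveRoot_conj_omega (b := b) (by omega)).pow_ne_one_of_pos_of_lt
    (l := c) (by omega) (by omega)
  exact norm_pos_iff.2 (sub_ne_zero.2 this.symm)

theorem mMax_le_two {b : ℕ} (hb : 2 ≤ b) : mMax b ≤ 2 := by
  have := nonempty_Icc hb
  refine ciSup_le fun c => (norm_sub_le _ _).trans ?_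
  rw [norm_one, norm_conj_omega_pow _ _ (by omega)]
  norm_num

/-- The `b - 1` numbers `1 - ω_b ^ (-c)` with `c ≠ 0` sum to `b`, so one has modulus at least `b /
(b - 1)`. This is needed when `α = 0` and `k ≠ 0`: no integration takes place, yet the factor `M_b`
is present. -/
theorem one_le_mMax {b : ℕ} (hb : 2 ≤ b) : 1 ≤ mMax b := by
  have hp := isPrimitiveRoot_conj_omega (b := b) (by omega)
  have h1 : ∑ c ∈ Finset.range b, (1 - conj (omega b) ^ c) = b := by
    rw [Finset.sum_sub_distrib, hp.geom_sum_eq_zero (by omega)]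
    simp
  obtain ⟨d, rfl⟩ : ∃ d, b = d + 1 := ⟨b - 1, by omega⟩
  rw [Finset.sum_range_succ'] at h1
  simp only [pow_zero, sub_self, add_zero] at h1
  have h2 : ((d + 1 : ℕ) : ℝ) ≤ d * mMax (d + 1) := by
    have h3 := norm_sum_le (Finset.range d) fun c => 1 - conj (omega (d + 1)) ^ (c + 1)
    rw [h1, Complex.norm_natCast] at h3
    refine h3.trans ((Finset.sum_le_sum fun c hc => le_mMax (b := d + 1) (c := c + 1)
      (by omega) (by have := Finset.mem_range.1 hc; omega)).trans_eq ?_)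
    simp
  have hd : (1 : ℝ) ≤ d := by exact_mod_cast (by omega : 1 ≤ d)
  push_cast at h2
  by_contra! hlt
  nlinarith

theorem mMin_le_digitRoot {b : ℕ} (hb : 2 ≤ b) {k a : ℕ} (ha : a ∈ positions b k) :
    mMin b ≤ ‖1 - digitRoot b k a‖ :=
  mMin_le (Nat.one_le_iff_ne_zero.2 (mem_positions ha).2)
    (Nat.le_sub_one_of_lt (getD_digits_lt hb k _))

theorem digitRoot_le_mMax {b : ℕ} (hb : 2 ≤ b) (k a c : ℕ) :
    ‖1 - digitRoot b k a ^ c‖ ≤ mMax b := by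
  have hp := (isPrimitiveRoot_conj_omega (b := b) (by omega)).pow_eq_one
  rw [digitRoot, ← pow_mul, pow_eq_pow_mod _ hp]
  rcases Nat.eq_zero_or_pos ((Nat.digits b k).getD (a - 1) 0 * c % b) with h | h
  · rw [h, pow_zero, sub_self, norm_zero]
    exact zero_le_one.trans (one_le_mMax hb)
  · exact le_mMax h (Nat.le_sub_one_of_lt (Nat.mod_lt _ (by omega)))

theorem primConst_eq_constC {b : ℕ} (hb : 2 < b) (n : ℕ) :
    primConst b (mMin b) (mMax b) n = constC b n := by
  have hM := mMax_le_two hb.le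
  have hb' : (2 : ℝ) < b := by exact_mod_cast hb
  have h1 : mMax b / b ≠ 1 := by
    rw [Ne, div_eq_one_iff_eq (by linarith)]
    linarith
  rw [primConst, constC, geom_sum_eq h1]
  have h2 : (b : ℝ) - mMax b ≠ 0 := by linarith
  have h4 : (b : ℝ) ≠ 0 := by linarith
  have h6 : mMax b / b - 1 = -((b - mMax b) / b) := by field_simp; ring
  rw [h6]
  field_simp
  ring

/-- The kernel of `conj (wal b k)` after `r` integrations. -/
noncomputable def walKernel (b k r : ℕ) : ℝ → ℂ := charKernel b (digitRoot b k) (positions b k) r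

theorem walKernel_zero {b : ℕ} [NeZero b] (k : ℕ) (x : ℝ) :
    walKernel b k 0 x = conj (wal b k x) := by
  rw [conj_wal, walKernel, charKernel]
  simp [iterInt]

theorem norm_walKernel_le {b : ℕ} (hb : 2 < b) {k α r : ℕ} (hr : r = min α (weight b k))
    {x : ℝ} (hx : 0 ≤ x) :
    ‖walKernel b k r x‖ ≤ (b : ℝ) ^ (-(mu b α k : ℤ)) / mMin b ^ r *
      (mMax b + constC b r) ^ min 1 (weight b k) := by
  have hroots := rootsOn_positions hb.le k
  have hb0 : b ≠ 0 := by omega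
  have htake : (positions b k).take r = (positions b k).take α := by
    rw [hr, weight, List.take_eq_take_min (i := α)]
  have hmu : mu b α k = ((positions b k).take r).reverse.sum := by
    rw [mu, htake, List.sum_reverse]
  have hlen : ((positions b k).take r).reverse.length = r := by
    rw [List.length_reverse, List.length_take, hr, weight]
    omega
  have hbound : (b : ℝ) ^ (-(mu b α k : ℤ)) / mMin b ^ r =
      meanBound b (mMin b) ((positions b k).take r).reverse := by
    rw [meanBound, hlen, hmu, zpow_neg, zpow_natCast]
  rw [walKernel, norm_charKernel hb0 hroots, hbound, ← primConst_eq_constC hb]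
  have h1 := hroots.reverse_take r
  have h2 := pairwise_reverse_take (pairwise_positions b k) r
  have hsub : ∀ a ∈ ((positions b k).take r).reverse, a ∈ positions b k :=
    fun a ha => List.mem_of_mem_take (List.mem_reverse.1 ha)
  generalize ((positions b k).take r).reverse = l at *
  cases l with
  | nil =>
    obtain rfl : r = 0 := hlen.symm
    simp only [iterInt, meanBound, primConst]
    simp only [norm_one, List.sum_nil, List.length_nil, pow_zero, inv_one, div_one, one_mul,
      Finset.range_zero, Finset.sum_empty, mul_zero, add_zero]
    exact one_le_pow₀ (one_le_mMax hb.le)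
  | cons a l =>
    rw [List.length_cons] at hlen
    have : min 1 (weight b k) = 1 := by omega
    rw [this, pow_one, ← hlen]
    exact norm_iterInt_cons_le hb0 (mMin_pos hb.le) (zero_le_one.trans (one_le_mMax hb.le)) h1 h2
      (fun c hc => mMin_le_digitRoot hb.le (hsub c hc))
      (fun a' _ c => digitRoot_le_mMax hb.le k a' c) hx

theorem digitRoot_two {k a : ℕ} (ha : a ∈ positions 2 k) : digitRoot 2 k a = -1 := by
  have h1 := (mem_positions ha).2
  have h2 := getD_digits_lt (b := 2) le_rfl k (a - 1)
  have h3 : (Nat.digits 2 k).getD (a - 1) 0 = 1 := by omega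
  have h4 : omega 2 = -1 := by
    rw [omega, ← Complex.exp_pi_mul_I]
    congr 1
    push_cast
    ring
  rw [digitRoot, h3, h4]
  simp

/-- `w` is the modulus of the kernel on `[0, ∞)`. All positions are at least `1`, so `[0, 1]` is a
union of full periods and the `L¹` norm is known exactly. -/
theorem walKernel_two {k α r : ℕ} (hr : r = min α (weight 2 k)) :
    ∃ w : ℝ → ℝ, Continuous w ∧ (∀ x, 0 ≤ x → ‖walKernel 2 k r x‖ = w x ∧ 0 ≤ w x ∧
      w x ≤ 2 ^ min 1 (weight 2 k) * (2 : ℝ) ^ (-(mu 2 α k : ℝ) - (r : ℝ))) ∧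
      ∫ x in (0 : ℝ)..1, w x = (2 : ℝ) ^ (-(mu 2 α k : ℝ) - (r : ℝ)) := by
  have hroots := rootsOn_positions (b := 2) le_rfl k
  have htake : (positions 2 k).take r = (positions 2 k).take α := by
    rw [hr, weight, List.take_eq_take_min (i := α)]
  have hmu : mu 2 α k = ((positions 2 k).take r).reverse.sum := by
    rw [mu, htake, List.sum_reverse]
  have hlen : ((positions 2 k).take r).reverse.length = r := by
    rw [List.length_reverse, List.length_take, hr, weight]
    omega
  have hbound : (2 : ℝ) ^ (-(mu 2 α k : ℝ) - (r : ℝ)) =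
      meanBound 2 2 ((positions 2 k).take r).reverse := by
    rw [meanBound, hlen, hmu, Real.rpow_sub two_pos, Real.rpow_neg two_pos.le,
      Real.rpow_natCast, Real.rpow_natCast]
    norm_num
  have h2 := pairwise_reverse_take (pairwise_positions 2 k) r
  have hsub : ∀ a ∈ ((positions 2 k).take r).reverse, a ∈ positions 2 k :=
    fun a ha => List.mem_of_mem_take (List.mem_reverse.1 ha)
  have hz : ∀ a ∈ ((positions 2 k).take r).reverse, digitRoot 2 k a = -1 :=
    fun a ha => digitRoot_two (hsub a ha)
  have h1 := hroots.reverse_take r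
  obtain ⟨w, hwc, hw⟩ := iterInt_two hz h2
  refine ⟨w, hwc, fun x hx => ?_, ?_⟩
  · obtain ⟨e1, e2, e3⟩ := hw x hx
    rw [walKernel, norm_charKernel two_ne_zero hroots, e1, Complex.norm_real,
      Real.norm_of_nonneg e2, hbound]
    refine ⟨rfl, e2, e3.trans ?_⟩
    have := meanBound_nonneg 2 two_pos ((positions 2 k).take r).reverse
    refine mul_le_mul_of_nonneg_right (pow_le_pow_right₀ one_le_two ?_) this
    rw [hlen]
    omega
  · have e1 := integral_iterInt two_ne_zero h1 h2 (a' := 0)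
      (fun a ha => (mem_positions (hsub a ha)).1)
    rw [iterMean_two hz, pow_zero, inv_one, Complex.ofReal_one, one_mul,
      intervalIntegral.integral_congr_Ioo_of_le zero_le_one
        fun t ht => (hw t ht.1.le).1, intervalIntegral.integral_ofReal] at e1
    rw [hbound]
    exact_mod_cast e1

/-! ### Integration by parts -/

/-- Integration by parts on `[0, 1]` turns `φ` into `Φ`, without boundary terms. -/
def ByParts (φ Φ : ℝ → ℂ) : Prop :=
  ∀ g : ℝ → ℝ, DifferentiableOn ℝ g (Set.Icc 0 1) →
    ContinuousOn (derivWithin g (Set.Icc 0 1)) (Set.Icc 0 1) →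
    ∫ x in (0 : ℝ)..1, (g x : ℂ) * φ x =
      -∫ x in (0 : ℝ)..1, ((derivWithin g (Set.Icc 0 1) x : ℝ) : ℂ) * Φ x

/-- A right-continuous function can be integrated by parts with its primitive. -/
theorem byParts_of_primitive {φ Φ : ℝ → ℂ} (hm : Measurable φ)
    (hint : ∀ u v, IntervalIntegrable φ volume u v)
    (hcont : ∀ x, 0 ≤ x → ContinuousWithinAt φ (Set.Ioi x) x)
    (hprim : ∀ x, 0 ≤ x → Φ x = ∫ t in (0 : ℝ)..x, φ t) (hone : Φ 1 = 0) : ByParts φ Φ := by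
  intro g hg hg'
  have hone' : ∫ t in (0 : ℝ)..1, φ t = 0 := by rw [← hprim 1 zero_le_one, hone]
  have huI : Set.uIcc (0 : ℝ) 1 = Set.Icc 0 1 := Set.uIcc_of_le zero_le_one
  have key := intervalIntegral.integral_mul_deriv_eq_deriv_mul_of_hasDeriv_right
    (a := 0) (b := 1) (u := fun x => (g x : ℂ))
    (u' := fun x => ((derivWithin g (Set.Icc 0 1) x : ℝ) : ℂ))
    (v := fun x => ∫ t in (0 : ℝ)..x, φ t) (v' := φ)
    (by rw [huI]; exact Complex.continuous_ofReal.comp_continuousOn hg.continuousOn)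
    (intervalIntegral.continuous_primitive hint 0).continuousOn ?_ ?_ ?_ (hint 0 1)
  · rw [key, hone', intervalIntegral.integral_same, mul_zero, mul_zero, sub_zero, zero_sub]
    congr 1
    refine intervalIntegral.integral_congr_Ioo_of_le zero_le_one fun x hx => ?_
    rw [hprim x hx.1.le]
  · intro x hx
    rw [min_eq_left zero_le_one, max_eq_right zero_le_one] at hx
    have := ((hg x ⟨hx.1.le, hx.2.le⟩).hasDerivWithinAt.hasDerivAt
      (Icc_mem_nhds hx.1 hx.2)).ofReal_comp
    exact this.hasDerivWithinAt
  · intro x hx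
    rw [min_eq_left zero_le_one, max_eq_right zero_le_one] at hx
    -- `φ` has jumps, so its primitive has in general only a right derivative, which this form of
    -- integration by parts allows.
    have h1 := intervalIntegral.integral_hasDerivWithinAt_right (hint 0 x) (s := Set.Ici x)
      (t := Set.Ioi x) hm.stronglyMeasurable.stronglyMeasurableAtFilter (hcont x hx.1.le)
    exact h1.mono Set.Ioi_subset_Ici_self
  · refine ContinuousOn.intervalIntegrable ?_
    rw [huI]
    exact Complex.continuous_ofReal.comp_continuousOn hg'

theorem walKernel_byParts {b : ℕ} (hb : 2 ≤ b) {k r : ℕ} (hr : r < weight b k) :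
    ByParts (walKernel b k r) (walKernel b k (r + 1)) := by
  have hb0 : b ≠ 0 := by omega
  have h := rootsOn_positions hb k
  have hl := pairwise_positions b k
  have hpos : ∀ a ∈ positions b k, 1 ≤ a := fun a ha => (mem_positions ha).1
  exact byParts_of_primitive (measurable_charKernel hb0 h r)
    (intervalIntegrable_charKernel hb0 h r)
    (fun x hx => charKernel_continuousWithinAt hb0 h r hx)
    (fun x hx => charKernel_succ hb0 h hl hpos hr hx)
    (charKernel_succ_one hb0 h hl hpos hr)

/-- Measurable and bounded on `[0, 1]`. -/
def MeasBdd (φ : ℝ → ℂ) : Prop :=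
  Measurable φ ∧ ∃ C : ℝ, ∀ x ∈ Set.Icc (0 : ℝ) 1, ‖φ x‖ ≤ C

theorem walKernel_measBdd {b : ℕ} (hb : 2 ≤ b) (k r : ℕ) : MeasBdd (walKernel b k r) := by
  have hb0 : b ≠ 0 := by omega
  have h := rootsOn_positions hb k
  refine ⟨measurable_charKernel hb0 h r, ?_⟩
  obtain ⟨C, hC⟩ := isCompact_Icc.exists_bound_of_continuousOn (s := Set.Icc (0 : ℝ) 1)
    (continuous_iterInt hb0 (h.reverse_take r)).continuousOn
  exact ⟨C, fun x hx => (norm_charKernel hb0 h r x).trans_le (hC x hx)⟩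

/-! ### Integration over the cube -/

theorem cube_eq_Icc (s : ℕ) : cube s = Set.Icc 0 1 :=
  Set.pi_univ_Icc (0 : Fin s → ℝ) 1

theorem isCompact_cube (s : ℕ) : IsCompact (cube s) := by
  rw [cube_eq_Icc]; exact isCompact_Icc

theorem measurableSet_cube (s : ℕ) : MeasurableSet (cube s) := (isCompact_cube s).measurableSet

theorem integrableOn_mul_prod {s : ℕ} {g : (Fin s → ℝ) → ℝ} (hg : ContinuousOn g (cube s))
    {φ : Fin s → ℝ → ℂ} (hφ : ∀ i, MeasBdd (φ i)) :
    IntegrableOn (fun x => (g x : ℂ) * ∏ i, φ i (x i)) (cube s) := by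
  obtain ⟨C, hC⟩ := (isCompact_cube s).exists_bound_of_continuousOn hg
  choose D hD using fun i => (hφ i).2
  have : IsFiniteMeasure (volume.restrict (cube s)) :=
    isFiniteMeasure_restrict.2 (isCompact_cube s).measure_lt_top.ne
  refine Integrable.of_bound ?_ (C * ∏ i, D i) ?_
  · refine ((Complex.continuous_ofReal.comp_continuousOn hg).aestronglyMeasurable
      (measurableSet_cube s)).mul ?_
    exact (Finset.measurable_prod _ fun i _ =>
      (hφ i).1.comp (measurable_pi_apply i)).aestronglyMeasurable
  · filter_upwards [ae_restrict_mem (measurableSet_cube s)] with x hx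
    rw [norm_mul, norm_prod, Complex.norm_real]
    refine mul_le_mul (hC x hx) (Finset.prod_le_prod (fun _ _ => norm_nonneg _)
      fun i _ => hD i _ (hx i trivial)) (Finset.prod_nonneg fun _ _ => norm_nonneg _)
      ((norm_nonneg _).trans (hC x hx))

theorem insertNth_mem_cube {s : ℕ} (j : Fin (s + 1)) {t : ℝ} {y : Fin s → ℝ} :
    j.insertNth (α := fun _ => ℝ) t y ∈ cube (s + 1) ↔ t ∈ Set.Icc (0 : ℝ) 1 ∧ y ∈ cube s := by
  simp only [cube, Set.mem_univ_pi, j.forall_iff_succAbove, Fin.insertNth_apply_same,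
    Fin.insertNth_apply_succAbove]

theorem integral_cube_succ {s : ℕ} (j : Fin (s + 1)) {F : (Fin (s + 1) → ℝ) → ℂ}
    (hF : IntegrableOn F (cube (s + 1))) :
    ∫ x in cube (s + 1), F x =
      ∫ y in cube s, ∫ t in (0 : ℝ)..1, F (j.insertNth (α := fun _ => ℝ) t y) := by
  set e : ℝ × (Fin s → ℝ) ≃ᵐ (Fin (s + 1) → ℝ) :=
    (MeasurableEquiv.piFinSuccAbove (fun _ => ℝ) j).symm
  have hem : MeasurePreserving e :=
    (volume_preserving_piFinSuccAbove (fun _ : Fin (s + 1) => ℝ) j).symm _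
  have hpre : e ⁻¹' cube (s + 1) = Set.Icc (0 : ℝ) 1 ×ˢ cube s := by
    ext ⟨t, y⟩
    exact insertNth_mem_cube j
  have hF' : IntegrableOn (F ∘ e) (Set.Icc (0 : ℝ) 1 ×ˢ cube s) := by
    rw [← hpre]
    exact (hem.integrableOn_comp_preimage e.measurableEmbedding).2 hF
  rw [← hem.map_eq, setIntegral_map_equiv, hpre, Measure.volume_eq_prod, ← Measure.prod_restrict]
  rw [IntegrableOn, Measure.volume_eq_prod, ← Measure.prod_restrict] at hF'
  refine (integral_prod_symm _ hF').trans ?_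
  refine setIntegral_congr_fun (measurableSet_cube s) fun y _ => ?_
  rw [intervalIntegral.integral_of_le zero_le_one, ← integral_Icc_eq_integral_Ioc]
  rfl

theorem prod_insertNth {s : ℕ} (j : Fin (s + 1)) (φ : Fin (s + 1) → ℝ → ℂ) (t : ℝ)
    (y : Fin s → ℝ) :
    ∏ i, φ i (j.insertNth (α := fun _ => ℝ) t y i) =
      φ j t * ∏ i, φ (j.succAbove i) (y i) := by
  rw [Fin.prod_univ_succAbove _ j]
  simp

/-- Integration by parts in the variable `x_j`. -/
theorem integral_cube_byParts {s : ℕ} (j : Fin s) {g : (Fin s → ℝ) → ℝ}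
    (hg : ContinuousOn g (cube s)) (hg' : ContinuousOn (partialDeriv j g) (cube s))
    (hd : ∀ x ∈ cube s, DifferentiableWithinAt ℝ (fun t => g (Function.update x j t))
      (Set.Icc 0 1) (x j))
    {φ : Fin s → ℝ → ℂ} (hφ : ∀ i, MeasBdd (φ i)) {Φ : ℝ → ℂ} (hΦ : MeasBdd Φ)
    (hparts : ByParts (φ j) Φ) :
    ∫ x in cube s, (g x : ℂ) * ∏ i, φ i (x i) =
      -∫ x in cube s, (partialDeriv j g x : ℂ) * ∏ i, Function.update φ j Φ i (x i) := by
  obtain ⟨s, rfl⟩ : ∃ m, s = m + 1 := ⟨s - 1, by have := j.2; omega⟩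
  have hφ' : ∀ i, MeasBdd (Function.update φ j Φ i) := by
    intro i
    rcases eq_or_ne i j with rfl | hi
    · rwa [Function.update_self]
    · rw [Function.update_of_ne hi]; exact hφ i
  rw [integral_cube_succ j (integrableOn_mul_prod hg hφ),
    integral_cube_succ j (integrableOn_mul_prod hg' hφ'), ← integral_neg]
  refine setIntegral_congr_fun (measurableSet_cube s) fun y hy => ?_
  simp only [prod_insertNth, Function.update_self,
    Function.update_of_ne (Fin.succAbove_ne j _)]
  set h : ℝ → ℝ := fun t => g (j.insertNth (α := fun _ => ℝ) t y) with hh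
  have hup : ∀ t, (fun t' => g (Function.update (j.insertNth (α := fun _ => ℝ) t y) j t')) = h := by
    intro t
    funext t'
    rw [hh, Fin.update_insertNth]
  have hpd : ∀ t, partialDeriv j g (j.insertNth (α := fun _ => ℝ) t y) =
      derivWithin h (Set.Icc 0 1) t := by
    intro t
    rw [partialDeriv, hup, Fin.insertNth_apply_same]
  have hdiff : DifferentiableOn ℝ h (Set.Icc 0 1) := by
    intro t ht
    have := hd _ ((insertNth_mem_cube j).2 ⟨ht, hy⟩)
    rwa [hup, Fin.insertNth_apply_same] at this
  have hcont : ContinuousOn (derivWithin h (Set.Icc 0 1)) (Set.Icc 0 1) := by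
    have hc : Continuous fun t : ℝ => j.insertNth (α := fun _ => ℝ) t y := by fun_prop
    have := hg'.comp hc.continuousOn (s := Set.Icc 0 1)
      fun t ht => (insertNth_mem_cube j).2 ⟨ht, hy⟩
    exact this.congr fun t _ => (hpd t).symm
  have key := hparts h hdiff hcont
  simp only [hpd, ← mul_assoc, intervalIntegral.integral_mul_const]
  rw [key, neg_mul]

/-! ### Mixed partial derivatives -/

/-- The operators before `j` in the fold are zeroth iterates, so the extra derivative is outermost.
No symmetry of mixed partials is used. -/
theorem foldr_partialDeriv_update {s : ℕ} {n : Fin s → ℕ} {j : Fin s} (h0 : ∀ i < j, n i = 0)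
    (f : (Fin s → ℝ) → ℝ) {l : List (Fin s)} (hl : l.Pairwise (· < ·)) (hj : j ∈ l) :
    l.foldr (fun i g => (partialDeriv i)^[Function.update n j (n j + 1) i] g) f =
      partialDeriv j (l.foldr (fun i g => (partialDeriv i)^[n i] g) f) := by
  induction l with
  | nil => simp at hj
  | cons a l ih =>
    rw [List.pairwise_cons] at hl
    rw [List.foldr_cons, List.foldr_cons]
    by_cases ha : a = j
    · subst ha
      have : l.foldr (fun i g => (partialDeriv i)^[Function.update n a (n a + 1) i] g) f =
          l.foldr (fun i g => (partialDeriv i)^[n i] g) f := by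
        refine List.foldr_ext _ _ _ fun i hi g => ?_
        rw [Function.update_of_ne (hl.1 i hi).ne']
      rw [this, Function.update_self, Function.iterate_succ_apply']
    · have hjl : j ∈ l := (List.mem_cons.1 hj).resolve_left (Ne.symm ha)
      rw [Function.update_of_ne ha, h0 a (hl.1 j hjl), Function.iterate_zero, id, id,
        ih hl.2 hjl]

theorem mixedPartial_update {s : ℕ} {n : Fin s → ℕ} {j : Fin s} (h0 : ∀ i < j, n i = 0)
    (f : (Fin s → ℝ) → ℝ) :
    mixedPartial (Function.update n j (n j + 1)) f = partialDeriv j (mixedPartial n f) :=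
  foldr_partialDeriv_update h0 f (List.pairwise_lt_finRange s) (List.mem_finRange j)

theorem mixedPartial_zero {s : ℕ} (f : (Fin s → ℝ) → ℝ) : mixedPartial 0 f = f := by
  unfold mixedPartial
  induction List.finRange s with
  | nil => rfl
  | cons a l ih => rw [List.foldr_cons, ih]; rfl

/-- The Walsh coefficient as an integral of a mixed partial derivative, up to sign. -/
theorem norm_walshCoeff_eq {s b : ℕ} [NeZero b] (hb : 2 ≤ b) (k α : Fin s → ℕ)
    {f : (Fin s → ℝ) → ℝ} (hf : HasContMixedPartials α f) (n : Fin s → ℕ) (hα : n ≤ α)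
    (hw : ∀ j, n j ≤ weight b (k j)) :
    ‖walshCoeff b (fun x => (f x : ℂ)) k‖ =
      ‖∫ x in cube s, (mixedPartial n f x : ℂ) * ∏ i, walKernel b (k i) (n i) (x i)‖ := by
  induction hN : ∑ j, n j generalizing n with
  | zero =>
    obtain rfl : n = 0 := funext fun j => (Finset.sum_eq_zero_iff.1 hN) j (Finset.mem_univ j)
    rw [mixedPartial_zero]
    congr 1
    rw [walshCoeff]
    have hae : Set.univ.pi (fun _ : Fin s => Set.Ico (0 : ℝ) 1) =ᵐ[volume] cube s :=
      Measure.pi_Ico_ae_eq_pi_Icc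
    rw [setIntegral_congr_set hae]
    simp only [walMulti, map_prod, ← walKernel_zero]
    rfl
  | succ N ih =>
    -- The least `j` with `n j ≠ 0` is the variable differentiated last, and the only one in which
    -- `HasContMixedPartials` supplies this last differentiability.
    obtain ⟨j, hnj, hlt⟩ : ∃ j, n j ≠ 0 ∧ ∀ i < j, n i = 0 := by
      have hne : (Finset.univ.filter fun j => n j ≠ 0).Nonempty := by
        by_contra hemp
        rw [Finset.not_nonempty_iff_eq_empty, Finset.filter_eq_empty_iff] at hemp
        have : ∑ j, n j = 0 := Finset.sum_eq_zero fun j hj => not_not.1 (hemp hj)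
        omega
      refine ⟨_, (Finset.mem_filter.1 (Finset.min'_mem _ hne)).2, fun i hi => ?_⟩
      by_contra h
      exact absurd (Finset.min'_le _ i (Finset.mem_filter.2 ⟨Finset.mem_univ i, h⟩)) (not_le.2 hi)
    obtain ⟨r, hr⟩ := Nat.exists_eq_succ_of_ne_zero hnj
    set n' := Function.update n j r with hn'
    have hn'j : n' j = r := Function.update_self ..
    have hn'ne : ∀ i, i ≠ j → n' i = n i := fun i hi => Function.update_of_ne hi ..
    have hn : n = Function.update n' j (n' j + 1) := by
      rw [hn'j, hn', Function.update_idem, ← Nat.succ_eq_add_one, ← hr, Function.update_eq_self]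
    have hle : n' ≤ n := by
      intro i
      change n' i ≤ n i
      rcases eq_or_ne i j with rfl | hi
      · rw [hn'j]; omega
      · rw [hn'ne i hi]
    have hsum : ∑ i, n' i = N := by
      have h1 := Finset.add_sum_erase Finset.univ n (Finset.mem_univ j)
      have h2 := Finset.add_sum_erase Finset.univ n' (Finset.mem_univ j)
      have h3 : ∑ i ∈ Finset.univ.erase j, n' i = ∑ i ∈ Finset.univ.erase j, n i :=
        Finset.sum_congr rfl fun i hi => hn'ne i (Finset.ne_of_mem_erase hi)
      omega
    have h0 : ∀ i < j, n' i = 0 := fun i hi => (hn'ne i hi.ne).trans (hlt i hi)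
    have hmp : mixedPartial n f = partialDeriv j (mixedPartial n' f) := by
      conv_lhs => rw [hn]
      exact mixedPartial_update h0 f
    rw [ih n' (hle.trans hα) (fun i => (hle i).trans (hw i)) hsum,
      integral_cube_byParts j (hf n' (hle.trans hα)).1 (hmp ▸ (hf n hα).1)
        ((hf n' (hle.trans hα)).2 j h0 (by have : n j ≤ α j := hα j; omega))
        (fun i => walKernel_measBdd hb (k i) (n' i)) (walKernel_measBdd hb (k j) (n' j + 1))
        (walKernel_byParts hb (by have := hw j; omega)), norm_neg, hmp]
    congr 3
    funext x
    congr 1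
    refine Finset.prod_congr rfl fun i _ => ?_
    rcases eq_or_ne i j with rfl | hi
    · rw [Function.update_self, hn'j, hr]
    · rw [Function.update_of_ne hi, hn'ne i hi]

/-! ### Hölder's inequality with a bounded kernel -/

/-- Hölder's inequality for a kernel with bounded sup norm, interpolating with its `L¹` norm. -/
theorem enorm_integral_mul_le {X : Type*} [MeasurableSpace X] {μ : Measure X} {g : X → ℝ}
    (hg : AEStronglyMeasurable g μ) {K : X → ℂ} (hK : Measurable K) {A : ℝ≥0∞}
    (hA : ∀ᵐ x ∂μ, ‖K x‖ₑ ≤ A) {p : ℝ≥0∞} (hp : 1 ≤ p) :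
    ‖∫ x, (g x : ℂ) * K x ∂μ‖ₑ ≤
      A ^ (p⁻¹).toReal * eLpNorm g p μ * (∫⁻ x, ‖K x‖ₑ ∂μ) ^ (1 - (p⁻¹).toReal) := by
  set ν := μ.withDensity fun x => ‖K x‖ₑ with hν
  have hac : ν ≪ μ := withDensity_absolutelyContinuous _ _
  have h1 : ‖∫ x, (g x : ℂ) * K x ∂μ‖ₑ ≤ eLpNorm g 1 ν := by
    refine (enorm_integral_le_lintegral_enorm _).trans_eq ?_
    rw [eLpNorm_one_eq_lintegral_enorm, hν,
      lintegral_withDensity_eq_lintegral_mul₀ hK.enorm.aemeasurable hg.enorm]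
    refine lintegral_congr fun x => ?_
    simp only [Pi.mul_apply]
    rw [enorm_mul, mul_comm, ← ofReal_norm (g x : ℂ), Complex.norm_real, ofReal_norm]
  -- Hölder is applied for the measure `ν` with density `|K|`; its total mass is the `L¹` norm of
  -- `K`, and `ν ≤ A • μ` supplies the power of `A`. The case `p = ∞` is included.
  have h2 := eLpNorm_le_eLpNorm_mul_rpow_measure_univ hp (hg.mono_ac hac)
  have h3 : eLpNorm g p ν ≤ A ^ (p⁻¹).toReal * eLpNorm g p μ := by
    have hle : ν ≤ A • μ := by
      rw [hν, ← withDensity_const]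
      exact withDensity_mono hA
    have := (eLpNorm_mono_measure g hle).trans (eLpNorm_smul_measure_le A g p μ)
    rwa [one_div, smul_eq_mul] at this
  have h4 : ν Set.univ = ∫⁻ x, ‖K x‖ₑ ∂μ := by
    rw [hν, withDensity_apply _ MeasurableSet.univ, Measure.restrict_univ]
  rw [h4, ENNReal.toReal_one, one_div_one, one_div, ← ENNReal.toReal_inv] at h2
  exact h1.trans (h2.trans (mul_le_mul_left h3 _))

theorem eLpNorm_cube_lt_top {s : ℕ} {g : (Fin s → ℝ) → ℝ} (hg : ContinuousOn g (cube s))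
    (p : ℝ≥0∞) : eLpNorm g p (volume.restrict (cube s)) < ∞ := by
  obtain ⟨C, hC⟩ := (isCompact_cube s).exists_bound_of_continuousOn hg
  have : IsFiniteMeasure (volume.restrict (cube s)) :=
    isFiniteMeasure_restrict.2 (isCompact_cube s).measure_lt_top.ne
  refine (MemLp.of_bound (hg.aestronglyMeasurable (measurableSet_cube s)) C ?_).eLpNorm_lt_top
  filter_upwards [ae_restrict_mem (measurableSet_cube s)] with x hx using hC x hx

theorem measurable_prod_walKernel {s b : ℕ} (hb : 2 ≤ b) (k n : Fin s → ℕ) :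
    Measurable fun x : Fin s → ℝ => ∏ i, walKernel b (k i) (n i) (x i) :=
  Finset.measurable_prod _ fun i _ =>
    (walKernel_measBdd hb (k i) (n i)).1.comp (measurable_pi_apply i)

theorem norm_integral_cube_le {s : ℕ} {g : (Fin s → ℝ) → ℝ} (hg : ContinuousOn g (cube s))
    {K : (Fin s → ℝ) → ℂ} (hK : Measurable K) {A : ℝ} (hA : ∀ x ∈ cube s, ‖K x‖ ≤ A) :
    ‖∫ x in cube s, (g x : ℂ) * K x‖ ≤ cubeNorm 1 g * A := by
  have hA' : ∀ᵐ x ∂(volume.restrict (cube s)), ‖K x‖ₑ ≤ ENNReal.ofReal A := by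
    filter_upwards [ae_restrict_mem (measurableSet_cube s)] with x hx
    rw [← ofReal_norm]
    exact ENNReal.ofReal_le_ofReal (hA x hx)
  have h := enorm_integral_mul_le (hg.aestronglyMeasurable (measurableSet_cube s)) hK hA' le_rfl
  simp only [inv_one, ENNReal.toReal_one, ENNReal.rpow_one, sub_self, ENNReal.rpow_zero,
    mul_one] at h
  have hA0 : 0 ≤ A := (norm_nonneg _).trans
    (hA 0 fun i _ => ⟨le_rfl, zero_le_one⟩)
  have h2 := ENNReal.toReal_mono
    (ENNReal.mul_ne_top ENNReal.ofReal_ne_top (eLpNorm_cube_lt_top hg 1).ne) h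
  rw [toReal_enorm, ENNReal.toReal_mul, ENNReal.toReal_ofReal hA0] at h2
  rw [cubeNorm, mul_comm]
  exact h2

theorem norm_integral_cube_le_rpow {s : ℕ} {g : (Fin s → ℝ) → ℝ} (hg : ContinuousOn g (cube s))
    {K : (Fin s → ℝ) → ℂ} (hK : Measurable K) {A B : ℝ} (hA : ∀ x ∈ cube s, ‖K x‖ ≤ A)
    (hB : ∫ x in cube s, ‖K x‖ = B) {p : ℝ≥0∞} (hp : 1 ≤ p) :
    ‖∫ x in cube s, (g x : ℂ) * K x‖ ≤
      cubeNorm p g * (A ^ (p⁻¹).toReal * B ^ (1 - (p⁻¹).toReal)) := by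
  have hA' : ∀ᵐ x ∂(volume.restrict (cube s)), ‖K x‖ₑ ≤ ENNReal.ofReal A := by
    filter_upwards [ae_restrict_mem (measurableSet_cube s)] with x hx
    rw [← ofReal_norm]
    exact ENNReal.ofReal_le_ofReal (hA x hx)
  have hA0 : 0 ≤ A := (norm_nonneg _).trans (hA 0 fun i _ => ⟨le_rfl, zero_le_one⟩)
  have hB0 : 0 ≤ B := hB ▸ integral_nonneg fun x => norm_nonneg _
  have : IsFiniteMeasure (volume.restrict (cube s)) :=
    isFiniteMeasure_restrict.2 (isCompact_cube s).measure_lt_top.ne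
  have hKint : IntegrableOn K (cube s) := by
    refine Integrable.of_bound hK.aestronglyMeasurable A ?_
    filter_upwards [ae_restrict_mem (measurableSet_cube s)] with x hx using hA x hx
  have hB' : ∫⁻ x in cube s, ‖K x‖ₑ = ENNReal.ofReal B := by
    rw [← hB, ofReal_integral_norm_eq_lintegral_enorm hKint]
  have hθ : (p⁻¹).toReal ≤ 1 := by
    rw [← ENNReal.toReal_one]
    exact ENNReal.toReal_mono ENNReal.one_ne_top (ENNReal.inv_le_one.2 hp)
  have h := enorm_integral_mul_le (hg.aestronglyMeasurable (measurableSet_cube s)) hK hA' hp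
  rw [hB', ENNReal.ofReal_rpow_of_nonneg hA0 ENNReal.toReal_nonneg,
    ENNReal.ofReal_rpow_of_nonneg hB0 (by linarith)] at h
  have h2 := ENNReal.toReal_mono (ENNReal.mul_ne_top (ENNReal.mul_ne_top ENNReal.ofReal_ne_top
    (eLpNorm_cube_lt_top hg p).ne) ENNReal.ofReal_ne_top) h
  rw [toReal_enorm, ENNReal.toReal_mul, ENNReal.toReal_mul, ENNReal.toReal_ofReal (by positivity),
    ENNReal.toReal_ofReal (by positivity)] at h2
  rw [cubeNorm]
  exact h2.trans_eq (by ring)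

theorem integral_cube_prod {s : ℕ} (w : Fin s → ℝ → ℝ) :
    ∫ x in cube s, ∏ i, w i (x i) = ∏ i, ∫ t in (0 : ℝ)..1, w i t := by
  rw [cube, volume_pi, Measure.restrict_pi_pi, integral_fintype_prod_eq_prod]
  refine Finset.prod_congr rfl fun i _ => ?_
  rw [intervalIntegral.integral_of_le zero_le_one, integral_Icc_eq_integral_Ioc]

end Walsh

theorem mainTheorem3 {s : ℕ} (b : ℕ) [NeZero b] (hb : 2 ≤ b) (k α n : Fin s → ℕ)
    (hn : ∀ j, n j = min (α j) (Walsh.weight b (k j)))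
    (f : (Fin s → ℝ) → ℝ) (hf : Walsh.HasContMixedPartials α f) :
    (2 < b →
      ‖Walsh.walshCoeff b (fun x => (f x : ℂ)) k‖ ≤
        Walsh.cubeNorm 1 (Walsh.mixedPartial n f) *
          ∏ j, ((b : ℝ) ^ (-(Walsh.mu b (α j) (k j) : ℤ)) / Walsh.mMin b ^ n j *
            (Walsh.mMax b + Walsh.constC b (n j)) ^ min 1 (Walsh.weight b (k j)))) ∧
    (b = 2 → ∀ p : ℝ≥0∞, 1 ≤ p →
      ‖Walsh.walshCoeff b (fun x => (f x : ℂ)) k‖ ≤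
        Walsh.cubeNorm p (Walsh.mixedPartial n f) *
          ∏ j, (2 : ℝ) ^ (-(Walsh.mu b (α j) (k j) : ℝ) - (n j : ℝ) +
            (min 1 (Walsh.weight b (k j)) : ℕ) * (p⁻¹).toReal)) := by
  have hα : n ≤ α := fun j => (hn j).trans_le (min_le_left _ _)
  have hw : ∀ j, n j ≤ Walsh.weight b (k j) := fun j => (hn j).trans_le (min_le_right _ _)
  have hcont := (hf n hα).1
  have hmeas := Walsh.measurable_prod_walKernel hb k n
  rw [Walsh.norm_walshCoeff_eq hb k α hf n hα hw]
  constructor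
  · intro hb2
    refine Walsh.norm_integral_cube_le hcont hmeas fun x hx => ?_
    rw [norm_prod]
    exact Finset.prod_le_prod (fun _ _ => norm_nonneg _)
      fun j _ => Walsh.norm_walKernel_le hb2 (hn j) (hx j trivial).1
  · rintro rfl p hp
    choose w hwc hwb hwi using fun j => Walsh.walKernel_two (hn j)
    set θ := (p⁻¹).toReal with hθ
    set Q : Fin s → ℝ := fun j => (2 : ℝ) ^ (-(Walsh.mu 2 (α j) (k j) : ℝ) - (n j : ℝ)) with hQ
    have hQpos : ∀ j, 0 < Q j := fun j => Real.rpow_pos_of_pos two_pos _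
    refine (Walsh.norm_integral_cube_le_rpow hcont hmeas
      (A := ∏ j, (2 ^ min 1 (Walsh.weight 2 (k j)) * Q j)) (B := ∏ j, Q j)
      (fun x hx => ?_) ?_ hp).trans_eq ?_
    · rw [norm_prod]
      refine Finset.prod_le_prod (fun _ _ => norm_nonneg _) fun j _ => ?_
      have h := hwb j (x j) (hx j trivial).1
      rw [h.1]
      exact h.2.2
    · rw [← Finset.prod_congr rfl fun j _ => hwi j, ← Walsh.integral_cube_prod]
      refine setIntegral_congr_fun (Walsh.measurableSet_cube s) fun x hx => ?_
      simp only [norm_prod]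
      exact Finset.prod_congr rfl fun j _ => (hwb j (x j) (hx j trivial).1).1
    · congr 1
      -- Factor by factor, `(2 ^ min(1, v) * Q) ^ θ * Q ^ (1 - θ) = Q * 2 ^ (θ min(1, v))`, with `θ
      -- = 1 / p`.
      rw [← Real.finsetProd_rpow _ _ fun j _ => by have := hQpos j; positivity,
        ← Real.finsetProd_rpow _ _ fun j _ => (hQpos j).le, ← Finset.prod_mul_distrib]
      refine Finset.prod_congr rfl fun j _ => ?_
      rw [Real.mul_rpow (by positivity) (hQpos j).le, mul_assoc, ← Real.rpow_add (hQpos j),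
        add_sub_cancel, Real.rpow_one, Real.rpow_add two_pos, mul_comm, ← Real.rpow_natCast,
        ← Real.rpow_mul two_pos.le]
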